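/- **Setting.** Let $k$ be a nonarchimedean local field of residual characteristic $\neq 2$, with ring of integers $\mathcal R$, maximal ideal $\mathcal P$, uniformizer $\varpi$ and valuation normalized by $\mathrm{val}(\varpi)=1$; let $\varepsilon\in\mathcal R^\times$ be a nonsquare, and let $\Psi:k\to\mathbb C^\times$ be an additive character trivial on $\mathcal P$ and nontrivial on $\mathcal R$. Put $\mathcal G=\mathrm{SL}_2(k)$, $\mathcal K=\mathrm{SL}_2(\mathcal R)$, $Z=\{\pm I\}$, let $U\subset\mathcal K$ be the upper triangular unipotent subgroup, $\mathcal K_n$ the subgroup of matrices in $\mathcal K$ congruent to $I$ mod $\mathcal P^n$, and $X(u,v)=\begin{pmatrix}0&u\\v&0\end{pmatrix}$. Write $A^g=gAg^{-1}$ and $\sigma^g(h)=\sigma(g^{-1}hg)$, and $\lceil x+\rceil=\lfloor x\rfloor+1$. *Tori.* Let $\mathcal T=\mathcal T_{\gamma_1,\gamma_2}$ be the group of matrices $\begin{pmatrix}a&b\gamma_1\\b\gamma_2&a\end{pmatrix}$ of determinant one, with $(\gamma_1,\gamma_2;y)$ one of $(1,\varepsilon;0)$, $(\varpi^{-1},\varepsilon\varpi;1)$,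 $(1,\varpi;\frac12)$, $(\varepsilon,\varepsilon^{-1}\varpi;\frac12)$, $(1,\varepsilon\varpi;\frac12)$, $(\varepsilon,\varpi;\frac12)$. For $\rho\ge0$ let $\mathcal T_{\rho+}$ be the set of these matrices with $a\in1+\mathcal P^{\lceil\rho+\rceil}$ and $b\gamma_1\in\mathcal P^{\lceil(\rho-y)+\rceil}$. Let $\phi$ be a character of $\mathcal T$ of depth $r>0$ (that is, $r$ is the least $\rho\geq 0$ with $\phi$ trivial on $\mathcal T_{\rho+}$), put $s=r/2$, and let $\Gamma=\mathsf a X(\gamma_1,\gamma_2)$ with $\mathrm{val}(\mathsf a\gamma_1)=-r-y$ satisfy $\phi(t)=\Psi(\mathrm{Tr}(\Gamma(t-I)))$ for all $t\in\mathcal T_{s+}$. *Double coset representatives.* Let $\mathsf e=\begin{pmatrix}x&y_0\\y_0&\varepsilon^{-1}x\end{pmatrix}$ with $x,y_0\in\mathcal R$, $x^2-y_0^2\varepsilon=\varepsilon$, let $\eta=\mathrm{diag}(1,\varpi)$ and $w=\begin{pmatrix}0&1\\-1&0\end{pmatrix}$, and let $\mathsf d=\mathsf e,\ \mathsf e^\eta,\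 w$ according as $y=0,1,\frac12$. Let $\mu=I$, or $\mu=\alpha^t\lambda$ with $\alpha^t=\mathrm{diag}(\varpi^{-t},\varpi^t)$, $t\in\mathbb Z_{>0}$ and $\lambda\in\{I,\mathsf d\}$ (with $t=0$ if $\mu=I$). Put $\delta(\mu)=2t-y$ if $y=\frac12$ and $\lambda=w$, and $\delta(\mu)=2t+y$ otherwise; put $d=r+\delta(\mu)$. Write $\Gamma^\mu=X(u,v)$. *Shalika's representations.* For $X=X(u,v)$, where $d\geq 1$ is an integer and $\mathrm{val}(v)>\mathrm{val}(u)=-d$, let $T(X)$ be the centralizer of $X$ in $\mathcal K$, and let $\mathcal G_{[0,\frac12],d/2}$ be the group of $g\in\mathcal K$ with diagonal entries in $1+\mathcal P^{\lceil d/2\rceil}$, $g_{12}\in\mathcal P^{\lceil d/2\rceil}$, $g_{21}\in\mathcal P^{\lceil (d+1)/2\rceil}$. If $\theta$ is a character of $T(X)$ that agrees with $\Psi_X(g)=\Psi(\mathrm{Tr}(X(g-I)))$ on $T(X)\cap\mathcal G_{[0,\frac12],d/2}$, let $\Psi_{\theta,X}$ be the unique character of $T(X)\mathcal G_{[0,\frac12],d/2}$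 extending both, and put $\mathcal S_d(\theta,X)=\mathrm{Ind}_{T(X)\mathcal G_{[0,1/2],d/2}}^{\mathcal K}\Psi_{\theta,X}$ (smooth induction). *Transfer.* For $X=X(u,v)$, $X'=X(u',v')$ and $t'\in T(X')$, the transfer of $t'$ to $T(X)$ is the element $t\in T(X)$ with $t_{12}=t'_{12}$ and $t_{11}\equiv t'_{11}$ modulo $(u^{-1}v-u'^{-1}v')\mathcal R$. **Proposition.** Suppose $d>\frac43r$. Then $d$ is a positive integer, $\mathcal S_d(\phi^\mu,\Gamma^\mu)$ is defined, and for $X'=X(u,0)$ one has $T(X')=ZU$. Every $t'\in ZU$ has a unique transfer $t\in T(\Gamma^\mu)$. There is a character $\theta'$ of $ZU=T(X')$ which agrees with $\phi$ on $Z$, for which $\mathcal S_d(\theta',X')$ is defined, and such that $$\mathcal S_d(\phi^\mu,\Gamma^\mu)\cong\mathcal S_d(\theta',X').$$ Explicitly, for $t'=\begin{pmatrix}z&b\\0&z\end{pmatrix}\in ZU$ with transfer $t\in T(\Gamma^\mu)$, $$\theta'(t')=\phi^\mu(t)\,\Psi(zbv)^{-1}.$$ If $d\le2r$, then $\theta'$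 has depth $r-\delta(\mu)=2r-d$ (that is, $2r-d$ is the least real $\rho\ge0$ such that $\theta'$ is trivial on $ZU\cap\mathcal K_{\lceil\rho+\rceil}$). If $d>2r$, then $\theta'$ is trivial on $U$. -/

import Mathlib

open scoped ValuativeRel MatrixGroups

noncomputable section

namespace SL2Branching

open Matrix

/-! ### Smooth induction of characters -/

section Induction

variable {G : Type*} [Group G] [TopologicalSpace G] [ContinuousMul G]

/-- The space of the (smoothly) induced representation `Ind_H^G χ`: locally constant functions
`f : G → ℂ` with `f (h g) = χ(h) f(g)`. It is used for compact `G` only, so there is no support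
condition. -/
def indSpace (H : Subgroup G) (χ : H →* ℂˣ) : Submodule ℂ (G → ℂ) where
  carrier := {f | (∀ (h : H) (g : G), f (h * g) = (χ h : ℂ) * f g) ∧ IsLocallyConstant f}
  add_mem' := by
    rintro f₁ f₂ ⟨h1, h1'⟩ ⟨h2, h2'⟩
    refine ⟨fun h g => ?_, h1'.add h2'⟩
    simp only [Pi.add_apply, h1, h2]
    ring
  zero_mem' := ⟨fun h g => by simp, IsLocallyConstant.const 0⟩
  smul_mem' := by
    rintro c f ⟨h1, h1'⟩
    refine ⟨fun h g => ?_, h1'.comp (fun x => c • x)⟩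
    simp only [Pi.smul_apply, smul_eq_mul, h1]
    ring

/-- The representation `Ind_H^G χ`, by right translation: `(x · f)(g) = f (g x)`. -/
def ind (H : Subgroup G) (χ : H →* ℂˣ) : Representation ℂ G (indSpace H χ) where
  toFun x :=
    { toFun := fun f => ⟨fun g => f.1 (g * x),
        fun h g => by
          have := f.2.1 h (g * x)
          rwa [← mul_assoc] at this,
        f.2.2.comp_continuous (continuous_mul_const x)⟩
      map_add' := fun _ _ => rfl
      map_smul' := fun _ _ => rfl }
  map_one' := by ext f g; simp
  map_mul' x y := by ext f g; simp [mul_assoc]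

end Induction

variable {k : Type*} [Field k] [ValuativeRel k]

/-! ### Fractional ideals and valuations -/

/-- The fractional ideal `𝒫^n` of `k`, for `n ∈ ℤ`, where `ϖ` is a uniformizer. -/
def fracIdeal (ϖ : 𝒪[k]) (n : ℤ) : Submodule 𝒪[k] k := Submodule.span 𝒪[k] {(ϖ : k) ^ n}

/-- `val(x) = n` for the valuation of `k` normalized by `val(ϖ) = 1`. -/
def HasVal (ϖ : 𝒪[k]) (x : k) (n : ℤ) : Prop :=
  x ∈ fracIdeal ϖ n ∧ x ∉ fracIdeal ϖ (n + 1)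

/-! ### Matrices, and the groups `𝒢 = SL₂(k)` and `𝒦 = SL₂(ℛ)` -/

/-- The antidiagonal matrix `X(u, v)`. -/
def antidiag {R : Type*} [Zero R] (u v : R) : Matrix (Fin 2) (Fin 2) R := !![0, u; v, 0]

/-- The inclusion of `𝒦 = SL₂(ℛ)` into `𝒢 = SL₂(k)`. -/
def incl : SL(2, 𝒪[k]) →* SL(2, k) := Matrix.SpecialLinearGroup.map 𝒪[k].subtype

/-- The conjugate `Y^g = g Y g⁻¹`. -/
def conj (g : SL(2, k)) (Y : Matrix (Fin 2) (Fin 2) k) : Matrix (Fin 2) (Fin 2) k :=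
  (g : Matrix (Fin 2) (Fin 2) k) * Y * ((g⁻¹ : SL(2, k)) : Matrix (Fin 2) (Fin 2) k)

/-! ### The anisotropic tori -/

/-- Labels for the six standard anisotropic tori `𝒯_{γ₁,γ₂}` of `SL₂(k)`. -/
inductive TorusLabel
  /-- `(γ₁, γ₂) = (1, ε)`, unramified, `y = 0` -/
  | unram₀
  /-- `(γ₁, γ₂) = (ϖ⁻¹, εϖ)`, unramified, `y = 1` -/
  | unram₁
  /-- `(γ₁, γ₂) = (1, ϖ)`, ramified, `y = 1/2` -/
  | ram₁
  /-- `(γ₁, γ₂) = (ε, ε⁻¹ϖ)`, ramified, `y = 1/2` -/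
  | ram₂
  /-- `(γ₁, γ₂) = (1, εϖ)`, ramified, `y = 1/2` -/
  | ram₃
  /-- `(γ₁, γ₂) = (ε, ϖ)`, ramified, `y = 1/2` -/
  | ram₄

namespace TorusLabel

/-- The parameter `γ₁`. -/
def γ₁ (ϖ : 𝒪[k]) (ε : 𝒪[k]ˣ) : TorusLabel → k
  | unram₀ => 1
  | unram₁ => (ϖ : k)⁻¹
  | ram₁ => 1
  | ram₂ => (ε : 𝒪[k])
  | ram₃ => 1
  | ram₄ => (ε : 𝒪[k])

/-- The parameter `γ₂`. -/
def γ₂ (ϖ : 𝒪[k]) (ε : 𝒪[k]ˣ) : TorusLabel → k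
  | unram₀ => (ε : 𝒪[k])
  | unram₁ => ((ε : 𝒪[k]) : k) * ϖ
  | ram₁ => ϖ
  | ram₂ => ((ε : 𝒪[k]) : k)⁻¹ * ϖ
  | ram₃ => ((ε : 𝒪[k]) : k) * ϖ
  | ram₄ => ϖ

/-- The coordinate `y` of the unique point of the building attached to the torus. -/
def y : TorusLabel → ℝ
  | unram₀ => 0
  | unram₁ => 1
  | _ => 1 / 2

end TorusLabel

/-- The torus `𝒯_{γ₁,γ₂}`: the group of all matrices `t(a,b) = [a, bγ₁; bγ₂, a]` of determinant one
with `a, b ∈ k`. (For the tori of the list, `a` and `b` are automatically integral.) -/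
def torus (γ₁ γ₂ : k) : Subgroup SL(2, k) where
  carrier := {g | ∃ a b : k, (g : Matrix (Fin 2) (Fin 2) k) = !![a, b * γ₁; b * γ₂, a]}
  mul_mem' := by
    rintro g h ⟨a, b, hg⟩ ⟨a', b', hh⟩
    refine ⟨a * a' + b * b' * γ₁ * γ₂, a * b' + b * a', ?_⟩
    rw [Matrix.SpecialLinearGroup.coe_mul, hg, hh]
    ext i j
    fin_cases i <;> fin_cases j <;> simp [Matrix.mul_apply, Fin.sum_univ_two] <;> ring
  one_mem' := ⟨1, 0, by ext i j; fin_cases i <;> fin_cases j <;> simp⟩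
  inv_mem' := by
    rintro g ⟨a, b, hg⟩
    refine ⟨a, -b, ?_⟩
    rw [Matrix.SpecialLinearGroup.coe_inv, hg, Matrix.adjugate_fin_two]
    ext i j
    fin_cases i <;> fin_cases j <;> simp

/-- The torus with a given label. -/
abbrev TorusLabel.torus (ϖ : 𝒪[k]) (ε : 𝒪[k]ˣ) (τ : TorusLabel) : Subgroup SL(2, k) :=
  SL2Branching.torus (τ.γ₁ ϖ ε) (τ.γ₂ ϖ ε)

/-- The basis element `X_𝒯 = X(γ₁, γ₂)` of the Lie algebra of the torus. -/
def TorusLabel.basis (ϖ : 𝒪[k]) (ε : 𝒪[k]ˣ) (τ : TorusLabel) : Matrix (Fin 2) (Fin 2) k :=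
  antidiag (τ.γ₁ ϖ ε) (τ.γ₂ ϖ ε)

/-- `t ∈ 𝒯_{ρ+}`, for real `ρ ≥ 0`, where `𝒯_{ρ+}` consists of the `t(a,b) ∈ 𝒯` with
`a ∈ 1 + 𝒫^⌈ρ+⌉` and `bγ₁ ∈ 𝒫^⌈(ρ+)-y⌉`; here `⌈x+⌉ = ⌊x⌋ + 1` is the least integer `> x`. -/
def InTorusFiltPlus (ϖ : 𝒪[k]) (ε : 𝒪[k]ˣ) (τ : TorusLabel) (ρ : ℝ) (t : τ.torus ϖ ε) : Prop :=
  t.1 0 0 - 1 ∈ fracIdeal ϖ (⌊ρ⌋ + 1) ∧ t.1 0 1 ∈ fracIdeal ϖ (⌊ρ - τ.y⌋ + 1)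

/-- The character `φ` of the torus has depth `r`: `r` is the least real `ρ ≥ 0` such that `φ` is
trivial on `𝒯_{ρ+}`. -/
def TorusHasDepth (ϖ : 𝒪[k]) (ε : 𝒪[k]ˣ) (τ : TorusLabel) (φ : τ.torus ϖ ε →* ℂˣ) (r : ℝ) : Prop :=
  IsLeast {ρ : ℝ | 0 ≤ ρ ∧ ∀ t, InTorusFiltPlus ϖ ε τ ρ t → φ t = 1} r

/-- The element `a X_𝒯` is `𝒢`-generic of depth `r`: `val(a γ₁) = -r - y`. -/
def IsGeneric (ϖ : 𝒪[k]) (ε : 𝒪[k]ˣ) (τ : TorusLabel) (r : ℝ) (a : k) : Prop :=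
  ∃ n : ℤ, (n : ℝ) = -r - τ.y ∧ HasVal ϖ (a * τ.γ₁ ϖ ε) n

/-- The value `Ψ(Tr(X(g - I)))`. -/
def psiTr (Ψ : AddChar k ℂ) (X : Matrix (Fin 2) (Fin 2) k) (g : SL(2, k)) : ℂ :=
  Ψ (Matrix.trace (X * ((g : Matrix (Fin 2) (Fin 2) k) - 1)))

/-- `Γ` represents the restriction of `φ` to `𝒯_{s+}`: `φ(t) = Ψ(Tr(Γ(t - I)))` for `t ∈ 𝒯_{s+}`. -/
def Represents (Ψ : AddChar k ℂ) (ϖ : 𝒪[k]) (ε : 𝒪[k]ˣ) (τ : TorusLabel) (φ : τ.torus ϖ ε →* ℂˣ)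
    (s : ℝ) (Γ : Matrix (Fin 2) (Fin 2) k) : Prop :=
  ∀ t, InTorusFiltPlus ϖ ε τ s t → (φ t : ℂ) = psiTr Ψ Γ t

/-! ### The double coset representatives `μ ∈ M(𝒯)` -/

/-- The matrix `α^t = diag(ϖ^{-t}, ϖ^t)`. -/
def alphaPow (ϖ : 𝒪[k]) (hϖ : Irreducible ϖ) (t : ℕ) : SL(2, k) :=
  ⟨!![(ϖ : k)⁻¹ ^ t, 0; 0, (ϖ : k) ^ t], by
    have h : (ϖ : k) ≠ 0 := by simpa using hϖ.ne_zero
    rw [Matrix.det_fin_two_of, ← mul_pow, inv_mul_cancel₀ h]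
    simp⟩

/-- The matrix `e = [x, y; y, ε⁻¹x]`, where `x² - y²ε = ε`. -/
def eMat (ε : 𝒪[k]ˣ) (x y : 𝒪[k]) (hxy : x ^ 2 - y ^ 2 * ε = ε) : SL(2, k) :=
  incl ⟨!![x, y; y, ((ε⁻¹ : 𝒪[k]ˣ) : 𝒪[k]) * x], by
    rw [Matrix.det_fin_two_of]
    have h : ((ε⁻¹ : 𝒪[k]ˣ) : 𝒪[k]) * ε = 1 := by simp
    linear_combination ((ε⁻¹ : 𝒪[k]ˣ) : 𝒪[k]) * hxy + (1 + y ^ 2) * h⟩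

/-- The conjugate `e^η = η e η⁻¹ = [x, yϖ⁻¹; yϖ, ε⁻¹x]`, where `η = diag(1, ϖ)`. -/
def eEtaMat (ϖ : 𝒪[k]) (hϖ : Irreducible ϖ) (ε : 𝒪[k]ˣ) (x y : 𝒪[k])
    (hxy : x ^ 2 - y ^ 2 * ε = ε) : SL(2, k) :=
  ⟨!![1, 0; 0, (ϖ : k)] * (eMat ε x y hxy : Matrix (Fin 2) (Fin 2) k) * !![1, 0; 0, (ϖ : k)⁻¹], by
    have h : (ϖ : k) ≠ 0 := by simpa using hϖ.ne_zero
    rw [Matrix.det_mul, Matrix.det_mul, Matrix.SpecialLinearGroup.det_coe, Matrix.det_fin_two_of,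
      Matrix.det_fin_two_of]
    field_simp
    simp⟩

/-- The matrix `w = [0, 1; -1, 0]`. -/
def wMat : SL(2, k) := ⟨!![0, 1; -1, 0], by simp [Matrix.det_fin_two_of]⟩

/-- The two elements `I`, `𝖽` of `Λ(𝒯)`. -/
inductive LambdaLabel
  | one
  | d

/-- The nontrivial element `𝖽` of `Λ(𝒯)`: it is `e`, `e^η`, or `w`. -/
def dMat (ϖ : 𝒪[k]) (hϖ : Irreducible ϖ) (ε : 𝒪[k]ˣ) (x y : 𝒪[k])
    (hxy : x ^ 2 - y ^ 2 * ε = ε) : TorusLabel → SL(2, k)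
  | .unram₀ => eMat ε x y hxy
  | .unram₁ => eEtaMat ϖ hϖ ε x y hxy
  | _ => wMat

/-- The element `λ` of `𝒢` with a given label. -/
def lambdaMat (ϖ : 𝒪[k]) (hϖ : Irreducible ϖ) (ε : 𝒪[k]ˣ) (x y : 𝒪[k])
    (hxy : x ^ 2 - y ^ 2 * ε = ε) (τ : TorusLabel) : LambdaLabel → SL(2, k)
  | .one => 1
  | .d => dMat ϖ hϖ ε x y hxy τ

/-- The index set of `M(𝒯) = {I} ∪ {α^t λ | t > 0, λ ∈ Λ(𝒯)}`. -/
structure MackeyIndex where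
  /-- the exponent `t` -/
  t : ℕ
  /-- the label of `λ` -/
  lam : LambdaLabel
  /-- for `t = 0` only `I` occurs -/
  pos_or : 0 < t ∨ lam = .one

/-- The element `μ = α^t λ` of `𝒢`. -/
def MackeyIndex.mat (μ : MackeyIndex) (ϖ : 𝒪[k]) (hϖ : Irreducible ϖ) (ε : 𝒪[k]ˣ) (x y : 𝒪[k])
    (hxy : x ^ 2 - y ^ 2 * ε = ε) (τ : TorusLabel) : SL(2, k) :=
  alphaPow ϖ hϖ μ.t * lambdaMat ϖ hϖ ε x y hxy τ μ.lam

/-- `δ(μ) = 2t - y` if `y = 1/2` and `λ = w`, and `δ(μ) = 2t + y` otherwise. -/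
def MackeyIndex.delta (μ : MackeyIndex) (τ : TorusLabel) : ℝ :=
  match τ, μ.lam with
  | .unram₀, _ => 2 * μ.t + τ.y
  | .unram₁, _ => 2 * μ.t + τ.y
  | _, .one => 2 * μ.t + τ.y
  | _, .d => 2 * μ.t - τ.y

/-! ### Subgroups of `𝒦` -/

/-- The centralizer `T(X)` of the matrix `X` in `𝒦`. -/
def centK (X : Matrix (Fin 2) (Fin 2) k) : Subgroup SL(2, 𝒪[k]) where
  carrier := {g | (incl g : Matrix (Fin 2) (Fin 2) k) * X = X * (incl g : Matrix (Fin 2) (Fin 2) k)}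
  mul_mem' := by
    intro g h hg hh
    simp only [Set.mem_ofPred_eq, map_mul, Matrix.SpecialLinearGroup.coe_mul] at *
    rw [mul_assoc, hh, ← mul_assoc, hg, mul_assoc]
  one_mem' := by simp
  inv_mem' := by
    intro g hg
    simp only [Set.mem_ofPred_eq, map_inv] at *
    have h1 : ((incl g)⁻¹ : SL(2, k)).1 * (incl g).1 = 1 := by
      rw [← Matrix.SpecialLinearGroup.coe_mul]; simp
    have h2 : (incl g).1 * ((incl g)⁻¹ : SL(2, k)).1 = 1 := by
      rw [← Matrix.SpecialLinearGroup.coe_mul]; simp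
    calc ((incl g)⁻¹ : SL(2, k)).1 * X
        = ((incl g)⁻¹ : SL(2, k)).1 * (X * (incl g).1) * ((incl g)⁻¹ : SL(2, k)).1 := by
          rw [mul_assoc, mul_assoc, h2, mul_one]
      _ = X * ((incl g)⁻¹ : SL(2, k)).1 := by
          rw [← hg, ← mul_assoc, h1, one_mul]

/-- The congruence subgroup `𝒦_n` of matrices in `𝒦` congruent to `I` modulo `𝒫^n`. -/
def congK (n : ℕ) : Subgroup SL(2, 𝒪[k]) :=
  (Matrix.SpecialLinearGroup.map (Ideal.Quotient.mk (𝓂[k] ^ n))).ker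

/-- The upper triangular unipotent subgroup `U` of `𝒦`. -/
def unipK : Subgroup SL(2, 𝒪[k]) where
  carrier := {g | ∃ b : 𝒪[k], (g : Matrix (Fin 2) (Fin 2) 𝒪[k]) = !![1, b; 0, 1]}
  mul_mem' := by
    rintro g h ⟨b, hg⟩ ⟨b', hh⟩
    refine ⟨b + b', ?_⟩
    rw [Matrix.SpecialLinearGroup.coe_mul, hg, hh]
    ext i j
    fin_cases i <;> fin_cases j <;> simp [Matrix.mul_apply, Fin.sum_univ_two, add_comm]
  one_mem' := ⟨0, by ext i j; fin_cases i <;> fin_cases j <;> simp⟩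
  inv_mem' := by
    rintro g ⟨b, hg⟩
    refine ⟨-b, ?_⟩
    rw [Matrix.SpecialLinearGroup.coe_inv, hg, Matrix.adjugate_fin_two]
    ext i j
    fin_cases i <;> fin_cases j <;> simp

/-- The group `𝒢_{[0,1/2],d/2} = 𝒢_{0,d/2} ∩ 𝒢_{1/2,d/2}` for an integer `d ≥ 1`: the matrices in `𝒦`
with diagonal entries in `1 + 𝒫^⌈d/2⌉`, upper right entry in `𝒫^⌈d/2⌉`, and lower left entry in
`𝒫^⌈(d+1)/2⌉`. (Division below is division of natural numbers, so `(d+1)/2 = ⌈d/2⌉` and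
`d/2 + 1 = ⌈(d+1)/2⌉`.) -/
def segK (d : ℕ) : Subgroup SL(2, 𝒪[k]) where
  carrier := {g | g 0 0 - 1 ∈ 𝓂[k] ^ ((d + 1) / 2) ∧ g 0 1 ∈ 𝓂[k] ^ ((d + 1) / 2) ∧
    g 1 0 ∈ 𝓂[k] ^ (d / 2 + 1) ∧ g 1 1 - 1 ∈ 𝓂[k] ^ ((d + 1) / 2)}
  mul_mem' := by
    rintro g h ⟨h1, h2, h3, h4⟩ ⟨h1', h2', h3', h4'⟩
    have hle : 𝓂[k] ^ (d / 2 + 1) ≤ 𝓂[k] ^ ((d + 1) / 2) := Ideal.pow_le_pow_right (by omega)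
    have e : ∀ i j, (g * h : SL(2, 𝒪[k])) i j = g i 0 * h 0 j + g i 1 * h 1 j := by
      intro i j
      rw [Matrix.SpecialLinearGroup.coe_mul, Matrix.mul_apply, Fin.sum_univ_two]
    refine ⟨?_, ?_, ?_, ?_⟩
    · rw [e, show g 0 0 * h 0 0 + g 0 1 * h 1 0 - 1
        = h 0 0 * (g 0 0 - 1) + (h 0 0 - 1) + h 1 0 * g 0 1 by ring]
      exact add_mem (add_mem (Ideal.mul_mem_left _ _ h1) h1') (Ideal.mul_mem_left _ _ h2)
    · rw [e]
      exact add_mem (Ideal.mul_mem_left _ _ h2') (Ideal.mul_mem_right _ _ h2)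
    · rw [e]
      exact add_mem (Ideal.mul_mem_right _ _ h3) (Ideal.mul_mem_left _ _ h3')
    · rw [e, show g 1 0 * h 0 1 + g 1 1 * h 1 1 - 1
        = h 1 1 * (g 1 1 - 1) + (h 1 1 - 1) + g 1 0 * h 0 1 by ring]
      exact add_mem (add_mem (Ideal.mul_mem_left _ _ h4) h4') (Ideal.mul_mem_left _ _ h2')
  one_mem' := by simp
  inv_mem' := by
    rintro g ⟨h1, h2, h3, h4⟩
    have e := Matrix.adjugate_fin_two (g : Matrix (Fin 2) (Fin 2) 𝒪[k])
    simp only [Set.mem_ofPred_eq, Matrix.SpecialLinearGroup.coe_inv, e]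
    simpa using ⟨h4, h2, h3, h1⟩

/-! ### The representations `S_d(θ, X)` -/

/-- The conditions on `X = X(u, v)` in the definition of `S_d(θ, X)`: `d` is a positive integer and
`val(v) > val(u) = -d`. -/
def IsShalikaElement (ϖ : 𝒪[k]) (d : ℕ) (u v : k) : Prop :=
  0 < d ∧ HasVal ϖ u (-d) ∧ v ∈ fracIdeal ϖ (-d + 1)

/-- `T(X) 𝒢_{[0,1/2],d/2}`. As `T(X)` normalizes `𝒢_{[0,1/2],d/2}`, the subgroup generated by the two is
their product. -/
def shalikaGroup (d : ℕ) (X : Matrix (Fin 2) (Fin 2) k) : Subgroup SL(2, 𝒪[k]) :=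
  centK X ⊔ segK d

/-- `χ` is a character of `T(X) 𝒢_{[0,1/2],d/2}` that extends `θ` on `T(X)` and
`Ψ_X : g ↦ Ψ(Tr(X(g - I)))` on `𝒢_{[0,1/2],d/2}`. -/
def IsShalikaChar (Ψ : AddChar k ℂ) (d : ℕ) (X : Matrix (Fin 2) (Fin 2) k) (θ : centK X →* ℂˣ)
    (χ : shalikaGroup d X →* ℂˣ) : Prop :=
  (∀ (g : SL(2, 𝒪[k])) (hg : g ∈ centK X), χ ⟨g, (le_sup_left : centK X ≤ _) hg⟩ = θ ⟨g, hg⟩) ∧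
  ∀ (g : SL(2, 𝒪[k])) (hg : g ∈ segK d),
    (χ ⟨g, (le_sup_right : segK d ≤ _) hg⟩ : ℂ) = psiTr Ψ X (incl g)

/-- There is at most one such extension. -/
theorem IsShalikaChar.unique {Ψ : AddChar k ℂ} {d : ℕ} {X : Matrix (Fin 2) (Fin 2) k}
    {θ : centK X →* ℂˣ} {χ χ' : shalikaGroup d X →* ℂˣ}
    (h : IsShalikaChar Ψ d X θ χ) (h' : IsShalikaChar Ψ d X θ χ') : χ = χ' := by
  have key : shalikaGroup d X ≤ (χ.eqLocus χ').map (shalikaGroup d X).subtype :=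
    sup_le
      (fun x hx => ⟨⟨x, (le_sup_left : centK X ≤ shalikaGroup d X) hx⟩,
        (h.1 x hx).trans (h'.1 x hx).symm, rfl⟩)
      (fun x hx => ⟨⟨x, (le_sup_right : segK d ≤ shalikaGroup d X) hx⟩,
        Units.ext ((h.2 x hx).trans (h'.2 x hx).symm), rfl⟩)
  refine MonoidHom.ext fun g => ?_
  obtain ⟨g', hg', e⟩ := key g.2
  obtain rfl : g' = g := Subtype.ext e
  exact hg'

open Classical in
/-- `Ψ_{θ,X}`: the unique character of `T(X) 𝒢_{[0,1/2],d/2}` that extends both `θ` and `Ψ_X` (with the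
junk value `1` if there is none). -/
def shalikaChar (Ψ : AddChar k ℂ) (d : ℕ) (X : Matrix (Fin 2) (Fin 2) k) (θ : centK X →* ℂˣ) :
    shalikaGroup d X →* ℂˣ :=
  if h : ∃ χ, IsShalikaChar Ψ d X θ χ then h.choose else 1

/-- The hypotheses under which `S_d(θ, X(u, v))` is defined: the conditions on `u`, `v`, `d`, the
agreement of `θ` with `Ψ_X` on `T(X) ∩ 𝒢_{[0,1/2],d/2}`, and the existence of `Ψ_{θ,X}`. -/
def IsShalikaDatum (Ψ : AddChar k ℂ) (ϖ : 𝒪[k]) (d : ℕ) (u v : k)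
    (θ : centK (antidiag u v) →* ℂˣ) : Prop :=
  IsShalikaElement ϖ d u v ∧
  (∀ t : centK (antidiag u v), t.1 ∈ segK d → (θ t : ℂ) = psiTr Ψ (antidiag u v) (incl t.1)) ∧
  ∃ χ, IsShalikaChar Ψ d (antidiag u v) θ χ

section Topology

variable [TopologicalSpace k] [IsNonarchimedeanLocalField k]

/-- Shalika's representation `S_d(θ, X) = Ind Ψ_{θ,X}` of `𝒦`, induced from `T(X) 𝒢_{[0,1/2],d/2}`. -/
def shalikaRep (Ψ : AddChar k ℂ) (d : ℕ) (X : Matrix (Fin 2) (Fin 2) k) (θ : centK X →* ℂˣ) :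
    Representation ℂ SL(2, 𝒪[k]) (indSpace (shalikaGroup d X) (shalikaChar Ψ d X θ)) :=
  ind (shalikaGroup d X) (shalikaChar Ψ d X θ)

end Topology

/-- The character `θ` of the subgroup `A` of `𝒦` has depth `m`: `m` is the least real `ρ ≥ 0` such that
`θ` is trivial on `A ∩ 𝒢_{0,ρ+}`; here `𝒢_{0,ρ+} = 𝒦_{⌊ρ⌋+1}`. -/
def CharHasDepth (A : Subgroup SL(2, 𝒪[k])) (θ : A →* ℂˣ) (m : ℝ) : Prop :=
  IsLeast {ρ : ℝ | 0 ≤ ρ ∧ ∀ t : A, t.1 ∈ congK (⌊ρ⌋₊ + 1) → θ t = 1} m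

/-! ### The conjugate character `φ^μ` and the transfer -/

/-- `t = t(a, b) ∈ T(X(u, v))` is the transfer of `t' = t(a', b') ∈ T(X(u', v'))`: `b = b'`, and
`a ≡ a'` modulo `𝒫^n` where `n = val(u⁻¹v - u'⁻¹v')`, that is, modulo `(u⁻¹v - u'⁻¹v') ℛ`. (The equation
`a² = 1 + b²u⁻¹v` holds because `t ∈ T(X(u, v))`.) -/
def IsTransfer (u v u' v' : k) (t' : centK (antidiag u' v')) (t : centK (antidiag u v)) : Prop :=
  t.1 0 1 = t'.1 0 1 ∧
  ∃ c : 𝒪[k], ((t.1 0 0 : 𝒪[k]) : k) - (t'.1 0 0 : 𝒪[k]) = c * (u⁻¹ * v - u'⁻¹ * v')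

theorem γ₁_ne_zero {ϖ : 𝒪[k]} (hϖ : Irreducible ϖ) (ε : 𝒪[k]ˣ) (τ : TorusLabel) :
    τ.γ₁ ϖ ε ≠ 0 := by
  have h : (ϖ : k) ≠ 0 := by simpa using hϖ.ne_zero
  have h' : ((ε : 𝒪[k]) : k) ≠ 0 := by simp
  cases τ <;> simp [TorusLabel.γ₁, h, h']

theorem IsGeneric.ne_zero {ϖ : 𝒪[k]} {ε : 𝒪[k]ˣ} {τ : TorusLabel} {r : ℝ} {a : k}
    (ha : IsGeneric ϖ ε τ r a) : a ≠ 0 := by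
  rintro rfl
  obtain ⟨n, -, -, h⟩ := ha
  exact h (by simp)

/-- If `g ∈ 𝒦` centralizes `Γ^μ`, where `Γ = a X_𝒯` is generic, then `g^{μ⁻¹} ∈ 𝒯`. -/
theorem conj_mem_torus {ϖ : 𝒪[k]} (hϖ : Irreducible ϖ) {ε : 𝒪[k]ˣ} {τ : TorusLabel} {r : ℝ}
    {a : k} (ha : IsGeneric ϖ ε τ r a) (μ : SL(2, k)) {X : Matrix (Fin 2) (Fin 2) k}
    (hX : conj μ (a • τ.basis ϖ ε) = X) (g : centK X) :
    μ⁻¹ * incl g.1 * μ ∈ τ.torus ϖ ε := by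
  have h1 : μ.1 * (μ⁻¹ : SL(2, k)).1 = 1 := by
    rw [← Matrix.SpecialLinearGroup.coe_mul]; simp
  have h2 : (μ⁻¹ : SL(2, k)).1 * μ.1 = 1 := by
    rw [← Matrix.SpecialLinearGroup.coe_mul]; simp
  have hg : (incl g.1).1 * X = X * (incl g.1).1 := g.2
  set Y := τ.basis ϖ ε with hY
  set G := (incl g.1).1
  set m := μ.1
  set m' := (μ⁻¹ : SL(2, k)).1
  have hX' : X = a • (m * Y * m') := by
    rw [← hX, conj, Matrix.mul_smul, Matrix.smul_mul]
  have hc : G * (m * Y * m') = m * Y * m' * G := by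
    rw [hX', Matrix.mul_smul, Matrix.smul_mul] at hg
    exact smul_right_injective _ ha.ne_zero hg
  have hh : (m' * G * m) * Y = Y * (m' * G * m) := by
    calc (m' * G * m) * Y = m' * (G * (m * Y * m')) * m := by
          simp only [mul_assoc, h2, mul_one]
      _ = m' * (m * Y * m' * G) * m := by rw [hc]
      _ = (m' * m) * Y * (m' * G * m) := by simp only [mul_assoc]
      _ = Y * (m' * G * m) := by rw [h2, one_mul]
  have hcoe : ((μ⁻¹ * incl g.1 * μ : SL(2, k)) : Matrix (Fin 2) (Fin 2) k) = m' * G * m := by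
    simp only [Matrix.SpecialLinearGroup.coe_mul]; rfl
  set N := m' * G * m
  have hγ := γ₁_ne_zero hϖ ε τ
  have e1 := congrFun (congrFun hh 0) 0
  have e2 := congrFun (congrFun hh 0) 1
  simp [hY, TorusLabel.basis, antidiag, Matrix.mul_apply, Fin.sum_univ_two] at e1 e2
  refine ⟨N 0 0, N 0 1 / τ.γ₁ ϖ ε, ?_⟩
  rw [hcoe]
  have e3 : N 1 1 = N 0 0 := by
    apply mul_right_cancel₀ hγ
    linear_combination -e2
  ext i j
  fin_cases i <;> fin_cases j
  · simp
  · simp [hγ]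
  · simp
    field_simp
    linear_combination -e1
  · simpa using e3

/-- The character `φ^μ(t) = φ(μ⁻¹ t μ)`, as a character of `T(Γ^μ)`, for `Γ = a X_𝒯` generic and
`X = Γ^μ`. -/
def conjChar {ϖ : 𝒪[k]} (hϖ : Irreducible ϖ) {ε : 𝒪[k]ˣ} {τ : TorusLabel} {r : ℝ} {a : k}
    (ha : IsGeneric ϖ ε τ r a) (φ : τ.torus ϖ ε →* ℂˣ) (μ : SL(2, k))
    {X : Matrix (Fin 2) (Fin 2) k} (hX : conj μ (a • τ.basis ϖ ε) = X) : centK X →* ℂˣ where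
  toFun g := φ ⟨μ⁻¹ * incl g.1 * μ, conj_mem_torus hϖ ha μ hX g⟩
  map_one' := by
    rw [← map_one φ]
    congr 1
    ext1
    simp
  map_mul' g h := by
    rw [← map_mul φ]
    congr 1
    ext1
    simp [mul_assoc]

end SL2Branching

end

open SL2Branching

/-! Write `q = u⁻¹ v` and `V = val(v)`. Conjugating `Γ` by `μ` gives `val(u) = -d` and `V = δ(μ) - r
= d - 2r`, so `val(q) = d + V`, and the hypothesis `d > 4r/3` says exactly `d + 2V > 0`. An element
of `T(X(u, v))` has rows `(a, b)` and `(q b, a)` with `a² = 1 + q b²`; for `v = 0` this becomes `(z,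
b)`, `(0, z)` with `z² = 1`.

The inequality `d + 2V > 0` makes `v` negligible in three ways. Since `val(q) > d/2`, an element
`t'` of `Z U` and its transfer `t` differ by an element of `segK d`, so both representations are
induced from the same subgroup (`IsTransfer.inv_mul_mem_segK`, `shalikaGroup_eq`). On `segK d` the
term `v g₁₂` of `Tr(X(g - I))` lies in `𝒫`, so `Ψ_X` and `Ψ_{X'}` coincide there (`psi_mul_eq_one`).
Finally, transfer is multiplicative up to an error that `φ^μ` does not see
(`IsNearIdentity.map_transfer_mul`).

Hence the inducing character `χ` for `X` also serves for `X'`. Its restriction to `Z U` is forced: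
`χ(t') = χ(t) χ(t'⁻¹ t)⁻¹`, and the second factor is `Ψ(u · z b q)⁻¹ = Ψ(z b v)⁻¹`
(`IsDegeneration.isShalikaChar`).

For the depth, `Γ` determines `φ^μ` near the identity: `φ^μ(t) = Ψ(2 b v)`. Dividing by `Ψ(b v)`
leaves `θ'(t') = Ψ(b v)`. This is trivial as soon as `b v ∈ 𝒫`, which gives depth `-V` if `V ≤ 0`
and triviality on all of `U` if `V > 0`. -/

namespace SL2Branching

open Matrix

/-! ### Arithmetic of fractional ideals and of the valuation. -/

section FracIdeal

variable {k : Type*} [Field k] [ValuativeRel k] {ϖ : 𝒪[k]}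

theorem mem_fracIdeal_iff {x : k} {n : ℤ} :
    x ∈ fracIdeal ϖ n ↔ ∃ c : 𝒪[k], x = c * (ϖ : k) ^ n := by
  simp only [fracIdeal, Submodule.mem_span_singleton, Subring.smul_def, smul_eq_mul, eq_comm]

theorem coe_ne_zero_of_irreducible (hϖ : Irreducible ϖ) : (ϖ : k) ≠ 0 := by
  simpa using hϖ.ne_zero

theorem mul_mem_fracIdeal (hϖ : Irreducible ϖ) {x y : k} {m n : ℤ} (hx : x ∈ fracIdeal ϖ m)
    (hy : y ∈ fracIdeal ϖ n) : x * y ∈ fracIdeal ϖ (m + n) := by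
  obtain ⟨c, rfl⟩ := mem_fracIdeal_iff.1 hx
  obtain ⟨e, rfl⟩ := mem_fracIdeal_iff.1 hy
  refine mem_fracIdeal_iff.2 ⟨c * e, ?_⟩
  rw [zpow_add₀ (coe_ne_zero_of_irreducible hϖ)]
  push_cast
  ring

theorem coe_mem_fracIdeal_zero (x : 𝒪[k]) : (x : k) ∈ fracIdeal ϖ 0 :=
  mem_fracIdeal_iff.2 ⟨x, by simp⟩

theorem coe_mul_mem_fracIdeal (hϖ : Irreducible ϖ) (c : 𝒪[k]) {x : k} {n : ℤ}
    (hx : x ∈ fracIdeal ϖ n) : (c : k) * x ∈ fracIdeal ϖ n := by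
  simpa using mul_mem_fracIdeal hϖ (coe_mem_fracIdeal_zero c) hx

theorem coe_mem_fracIdeal_natCast {x : 𝒪[k]} {n : ℕ} :
    (x : k) ∈ fracIdeal ϖ n ↔ ∃ c : 𝒪[k], x = c * ϖ ^ n := by
  rw [mem_fracIdeal_iff]
  refine exists_congr fun c => ?_
  rw [zpow_natCast, Subtype.ext_iff]
  push_cast
  rfl

theorem fracIdeal_anti (hϖ : Irreducible ϖ) {m n : ℤ} (h : m ≤ n) {x : k}
    (hx : x ∈ fracIdeal ϖ n) : x ∈ fracIdeal ϖ m := by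
  obtain ⟨c, rfl⟩ := mem_fracIdeal_iff.1 hx
  obtain ⟨j, rfl⟩ := Int.le.dest h
  refine mem_fracIdeal_iff.2 ⟨c * ϖ ^ j, ?_⟩
  rw [zpow_add₀ (coe_ne_zero_of_irreducible hϖ), zpow_natCast]
  push_cast
  ring

theorem HasVal.mem {x : k} {n : ℤ} (h : HasVal ϖ x n) : x ∈ fracIdeal ϖ n := h.1

theorem HasVal.ne_zero {x : k} {n : ℤ} (h : HasVal ϖ x n) : x ≠ 0 := by
  rintro rfl
  exact h.2 (zero_mem _)

theorem HasVal.neg {x : k} {n : ℤ} (hx : HasVal ϖ x n) : HasVal ϖ (-x) n :=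
  ⟨neg_mem hx.1, fun h => hx.2 (by simpa using neg_mem h)⟩

variable [TopologicalSpace k] [IsNonarchimedeanLocalField k]

theorem mem_maximalIdeal_pow_iff (hϖ : Irreducible ϖ) {x : 𝒪[k]} {n : ℕ} :
    x ∈ 𝓂[k] ^ n ↔ (x : k) ∈ fracIdeal ϖ n := by
  rw [hϖ.maximalIdeal_eq, Ideal.span_singleton_pow, Ideal.mem_span_singleton',
    coe_mem_fracIdeal_natCast]
  simp only [eq_comm]

theorem mem_maximalIdeal_iff (hϖ : Irreducible ϖ) {x : 𝒪[k]} :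
    x ∈ 𝓂[k] ↔ (x : k) ∈ fracIdeal ϖ 1 := by
  simpa using mem_maximalIdeal_pow_iff hϖ (x := x) (n := 1)

theorem hasVal_iff (hϖ : Irreducible ϖ) {x : k} {n : ℤ} :
    HasVal ϖ x n ↔ ∃ c : 𝒪[k]ˣ, x = (c : 𝒪[k]) * (ϖ : k) ^ n := by
  have h0 := coe_ne_zero_of_irreducible hϖ
  constructor
  · rintro ⟨h, h'⟩
    obtain ⟨c, rfl⟩ := mem_fracIdeal_iff.1 h
    by_cases hc : IsUnit c
    · exact ⟨hc.unit, rfl⟩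
    · have hc' : c ∈ 𝓂[k] := (IsLocalRing.mem_maximalIdeal c).2 hc
      rw [mem_maximalIdeal_iff hϖ] at hc'
      have h1 : (ϖ : k) ^ n ∈ fracIdeal ϖ n := mem_fracIdeal_iff.2 ⟨1, by simp⟩
      rw [add_comm] at h'
      exact absurd (mul_mem_fracIdeal hϖ hc' h1) h'
  · rintro ⟨c, rfl⟩
    refine ⟨mem_fracIdeal_iff.2 ⟨c, rfl⟩, fun h => ?_⟩
    obtain ⟨e, he⟩ := mem_fracIdeal_iff.1 h
    rw [zpow_add₀ h0, zpow_one] at he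
    have h1 : ((c : 𝒪[k]) : k) = e * ϖ := by
      apply mul_right_cancel₀ (zpow_ne_zero n h0)
      rw [he]
      ring
    have h2 : (c : 𝒪[k]) = e * ϖ := Subtype.ext h1
    exact hϖ.not_isUnit (isUnit_of_dvd_unit ⟨e, by rw [h2, mul_comm]⟩ c.isUnit)

theorem HasVal.mul (hϖ : Irreducible ϖ) {x y : k} {m n : ℤ} (hx : HasVal ϖ x m)
    (hy : HasVal ϖ y n) : HasVal ϖ (x * y) (m + n) := by
  obtain ⟨c, rfl⟩ := (hasVal_iff hϖ).1 hx
  obtain ⟨e, rfl⟩ := (hasVal_iff hϖ).1 hy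
  refine (hasVal_iff hϖ).2 ⟨c * e, ?_⟩
  rw [zpow_add₀ (coe_ne_zero_of_irreducible hϖ)]
  push_cast
  ring

theorem hasVal_unit (hϖ : Irreducible ϖ) (c : 𝒪[k]ˣ) : HasVal ϖ ((c : 𝒪[k]) : k) 0 :=
  (hasVal_iff hϖ).2 ⟨c, by simp⟩

theorem hasVal_zpow (hϖ : Irreducible ϖ) (n : ℤ) : HasVal ϖ ((ϖ : k) ^ n) n :=
  (hasVal_iff hϖ).2 ⟨1, by simp⟩

theorem HasVal.inv (hϖ : Irreducible ϖ) {x : k} {n : ℤ} (hx : HasVal ϖ x n) :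
    HasVal ϖ x⁻¹ (-n) := by
  obtain ⟨c, rfl⟩ := (hasVal_iff hϖ).1 hx
  refine (hasVal_iff hϖ).2 ⟨c⁻¹, ?_⟩
  have h : (((c⁻¹ : 𝒪[k]ˣ) : 𝒪[k]) : k) = ((c : 𝒪[k]) : k)⁻¹ := by
    apply eq_inv_of_mul_eq_one_left
    rw [← Subring.coe_mul]
    simp
  rw [h, mul_inv, _root_.zpow_neg]

/-- Division by an element of valuation `n` shifts the filtration by `-n`. -/
theorem mem_fracIdeal_of_mul_mem (hϖ : Irreducible ϖ) {x y : k} {m n : ℤ} (hx : HasVal ϖ x n)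
    (h : x * y ∈ fracIdeal ϖ (n + m)) : y ∈ fracIdeal ϖ m := by
  have := mul_mem_fracIdeal hϖ (hx.inv hϖ).mem h
  rwa [inv_mul_cancel_left₀ hx.ne_zero, neg_add_cancel_left] at this

end FracIdeal

/-! ### Square roots of units in odd residual characteristic. -/

section SquareRoots

variable {k : Type*} [Field k] [ValuativeRel k] [TopologicalSpace k]
  [IsNonarchimedeanLocalField k]

theorem isUnit_two (hp : ringChar 𝓀[k] ≠ 2) : IsUnit (2 : 𝒪[k]) := by
  have h := Ring.two_ne_zero hp
  rw [← map_ofNat (IsLocalRing.residue 𝒪[k]) 2, IsLocalRing.residue_ne_zero_iff_isUnit] at h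
  exact h

theorem henselianRing_integer : HenselianRing 𝒪[k] 𝓂[k] :=
  -- The instance search needs a uniform structure on `k`; that of the additive topological group is
  -- supplied locally.
  letI := IsTopologicalAddGroup.rightUniformSpace k
  haveI := isUniformAddGroup_of_addCommGroup (G := k)
  inferInstance

theorem isUnit_of_sub_mem {x y : 𝒪[k]} (hx : IsUnit x) (h : x - y ∈ 𝓂[k]) : IsUnit y := by
  by_contra hy
  have := add_mem h ((IsLocalRing.mem_maximalIdeal y).2 hy)
  rw [sub_add_cancel] at this
  exact (IsLocalRing.mem_maximalIdeal x).1 this hx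

theorem isUnit_add_of_sub_mem (hp : ringChar 𝓀[k] ≠ 2) {x y : 𝒪[k]} (hx : IsUnit x)
    (h : x - y ∈ 𝓂[k]) : IsUnit (x + y) :=
  isUnit_of_sub_mem ((isUnit_two hp).mul hx) (by convert! h using 1; ring)

/-- Since `x + y ≡ 2x` is a unit, it cancels from `(x + y)(x - y) = 0`. -/
theorem eq_of_sq_eq_of_sub_mem (hp : ringChar 𝓀[k] ≠ 2) {x y : 𝒪[k]} (hx : IsUnit x)
    (h : x - y ∈ 𝓂[k]) (hxy : x ^ 2 = y ^ 2) : x = y := by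
  have h1 : (x + y) * (x - y) = 0 := by linear_combination hxy
  exact sub_eq_zero.1 ((isUnit_add_of_sub_mem hp hx h).mul_right_eq_zero.1 h1)

/-- An element that is a square modulo the maximal ideal is a square. -/
theorem exists_sq_eq (hp : ringChar 𝓀[k] ≠ 2) {z c : 𝒪[k]} (hz : IsUnit z)
    (hc : z ^ 2 - c ∈ 𝓂[k]) : ∃ a, a ^ 2 = c ∧ a - z ∈ 𝓂[k] := by
  have := henselianRing_integer (k := k)
  obtain ⟨a, ha, ha'⟩ := HenselianRing.is_henselian (I := 𝓂[k])
    (Polynomial.X ^ 2 - Polynomial.C c) (Polynomial.monic_X_pow_sub_C c two_ne_zero) z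
    (by simpa using hc) (by
      have h : IsUnit (2 * z) := (isUnit_two hp).mul hz
      simpa [Polynomial.derivative_X_pow, one_add_one_eq_two] using
        h.map (Ideal.Quotient.mk 𝓂[k]))
  refine ⟨a, ?_, ha'⟩
  simpa [Polynomial.IsRoot.def, sub_eq_zero] using ha

end SquareRoots

/-! ### Characters of a product of two subgroups, and equality of induction data. -/

section Groups

/-- Characters of `A` and `B` that agree on `A ∩ B` extend to `A B` if `A` normalizes `B` and fixes
the character of `B`. -/
theorem exists_char_sup {G M : Type*} [Group G] [CommGroup M] {A B : Subgroup G}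
    (θ : A →* M) (ψ : B →* M) (hAB : ∀ a ∈ A, ∀ b ∈ B, a * b * a⁻¹ ∈ B)
    (hψ : ∀ (a : G) (ha : a ∈ A) (b : G) (hb : b ∈ B), ψ ⟨_, hAB a ha b hb⟩ = ψ ⟨b, hb⟩)
    (hag : ∀ (g : G) (hA : g ∈ A) (hB : g ∈ B), θ ⟨g, hA⟩ = ψ ⟨g, hB⟩) :
    ∃ χ : (A ⊔ B : Subgroup G) →* M,
      (∀ (g : G) (hg : g ∈ A), χ ⟨g, (le_sup_left : A ≤ _) hg⟩ = θ ⟨g, hg⟩) ∧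
      ∀ (g : G) (hg : g ∈ B), χ ⟨g, (le_sup_right : B ≤ _) hg⟩ = ψ ⟨g, hg⟩ := by
  have hle : A ≤ Subgroup.normalizer B := fun a ha => by
    rw [Subgroup.mem_normalizer_iff]
    refine fun b => ⟨hAB a ha b, fun h => ?_⟩
    have := hAB a⁻¹ (inv_mem ha) _ h
    simpa [mul_assoc] using this
  have hmem : ∀ g : (A ⊔ B : Subgroup G), ∃ a : A, ∃ b : B, (a : G) * b = g := by
    rintro ⟨g, hg⟩
    rw [← SetLike.mem_coe, Subgroup.coe_mul_of_left_le_normalizer_right A B hle] at hg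
    obtain ⟨a, ha, b, hb, h⟩ := hg
    exact ⟨⟨a, ha⟩, ⟨b, hb⟩, h⟩
  -- The factorizations are arbitrary choices; `key` shows that `θ a * ψ b` depends only on the
  -- product `a b`.
  choose f₁ f₂ hf using hmem
  have key : ∀ (a a' : A) (b b' : B), (a : G) * b = a' * b' → θ a * ψ b = θ a' * ψ b' := by
    intro a a' b b' h
    have h1 : ((a' : G)⁻¹ * a) = b' * (b : G)⁻¹ := by
      rw [inv_mul_eq_iff_eq_mul, ← mul_assoc, ← h]
      simp
    have h2 : (a' : G)⁻¹ * a ∈ B := h1 ▸ mul_mem b'.2 (inv_mem b.2)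
    have h3 : θ (a'⁻¹ * a) = ψ (b' * b⁻¹) := by
      have h4 := hag _ (a'⁻¹ * a).2 h2
      rw [Subtype.coe_eta] at h4
      rw [h4]
      congr 1
      exact Subtype.ext h1
    rw [map_mul, map_inv, map_mul, map_inv, inv_mul_eq_iff_eq_mul] at h3
    rw [h3, ← mul_assoc]
    simp
  refine ⟨MonoidHom.mk' (fun g => θ (f₁ g) * ψ (f₂ g)) fun g h => ?_, fun g hg => ?_,
    fun g hg => ?_⟩
  -- Uses `a b a' b' = (a a') ((a'⁻¹ b a') b')`; the invariance of `ψ` then removes the conjugation.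
  · have hb := hAB _ (inv_mem (f₁ h).2) _ (f₂ g).2
    have h1 := key (f₁ (g * h)) (f₁ g * f₁ h) (f₂ (g * h)) (⟨_, hb⟩ * f₂ h) (by
      rw [hf]
      push_cast
      rw [← hf g, ← hf h]
      group)
    rw [h1, map_mul, map_mul, hψ _ (inv_mem (f₁ h).2)]
    exact mul_mul_mul_comm ..
  · have := key (f₁ ⟨g, (le_sup_left : A ≤ A ⊔ B) hg⟩) ⟨g, hg⟩
      (f₂ ⟨g, (le_sup_left : A ≤ A ⊔ B) hg⟩) 1 (by rw [hf]; simp)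
    simpa using this
  · have := key (f₁ ⟨g, (le_sup_right : B ≤ A ⊔ B) hg⟩) 1
      (f₂ ⟨g, (le_sup_right : B ≤ A ⊔ B) hg⟩) ⟨g, hg⟩ (by rw [hf]; simp)
    simpa using this

/-- The final isomorphism comes from equal induction data; transport along `H = H'` is confined to
this lemma. -/
theorem nonempty_ind_equiv {G : Type*} [Group G] [TopologicalSpace G] [ContinuousMul G]
    {H H' : Subgroup G} (h : H = H') {χ : H →* ℂˣ} {χ' : H' →* ℂˣ}
    (hχ : ∀ (g : G) (hg : g ∈ H) (hg' : g ∈ H'), χ ⟨g, hg⟩ = χ' ⟨g, hg'⟩) :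
    Nonempty ((ind H χ).Equiv (ind H' χ')) := by
  subst h
  obtain rfl : χ = χ' := MonoidHom.ext fun g => hχ g g.2 g.2
  exact ⟨Representation.Equiv.refl _⟩

end Groups

/-! ### Coordinates on the centralizers `T(X(u, v))`. -/

section Centralizer

variable {k : Type*} [Field k] [ValuativeRel k]

theorem incl_coe (g : SL(2, 𝒪[k])) (i j : Fin 2) :
    (incl g : Matrix (Fin 2) (Fin 2) k) i j = (g i j : 𝒪[k]) := rfl

theorem psiTr_antidiag (Ψ : AddChar k ℂ) (u v : k) (g : SL(2, 𝒪[k])) :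
    psiTr Ψ (antidiag u v) (incl g) = Ψ (u * (g 1 0 : 𝒪[k]) + v * (g 0 1 : 𝒪[k])) := by
  rw [psiTr]
  congr 1
  simp [Matrix.trace_fin_two, antidiag, Matrix.vecMul, dotProduct, Fin.sum_univ_two, incl_coe]

/-- Taking the quotient `q = v / u` in `𝒪[k]` keeps all centralizer computations integral, and `q =
0` covers `T(X')`. -/
theorem mem_centK_antidiag_iff {u v : k} (hu : u ≠ 0) {q : 𝒪[k]} (hq : (q : k) * u = v)
    {g : SL(2, 𝒪[k])} :
    g ∈ centK (antidiag u v) ↔ g 1 1 = g 0 0 ∧ g 1 0 = q * g 0 1 := by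
  have h : g ∈ centK (antidiag u v) ↔
      (incl g : Matrix (Fin 2) (Fin 2) k) * antidiag u v
        = antidiag u v * (incl g : Matrix (Fin 2) (Fin 2) k) := Iff.rfl
  rw [h, ← Matrix.ext_iff]
  simp only [Fin.forall_fin_two, antidiag, Matrix.mul_apply, Fin.sum_univ_two, incl_coe,
    Matrix.of_apply, Matrix.cons_val', Matrix.cons_val_zero, Matrix.cons_val_one,
    Matrix.cons_val_fin_one, mul_zero, zero_mul, zero_add, add_zero]
  rw [← hq]
  constructor
  · rintro ⟨⟨h1, h2⟩, -, -⟩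
    constructor <;> apply Subtype.ext <;> push_cast <;> apply mul_right_cancel₀ hu
    · linear_combination -h2
    · linear_combination -h1
  · rintro ⟨h1, h2⟩
    rw [h1, h2]
    push_cast
    refine ⟨⟨?_, ?_⟩, ?_, ?_⟩ <;> ring

/-- The determinant equation `a² - q b² = 1` for elements of the centralizer. -/
theorem centK_sq {q : 𝒪[k]} {g : SL(2, 𝒪[k])} (h : g 1 1 = g 0 0 ∧ g 1 0 = q * g 0 1) :
    g 0 0 ^ 2 = 1 + q * g 0 1 ^ 2 := by
  have hd := g.det_coe
  rw [Matrix.det_fin_two, h.1, h.2] at hd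
  linear_combination hd

theorem SL2_mul_apply (g h : SL(2, 𝒪[k])) (i j : Fin 2) :
    (g * h) i j = g i 0 * h 0 j + g i 1 * h 1 j := by
  rw [Matrix.SpecialLinearGroup.coe_mul, Matrix.mul_apply, Fin.sum_univ_two]

theorem SL2_inv_coe (g : SL(2, 𝒪[k])) :
    ((g⁻¹ : SL(2, 𝒪[k])) : Matrix (Fin 2) (Fin 2) 𝒪[k]) = !![g 1 1, -g 0 1; -g 1 0, g 0 0] := by
  rw [Matrix.SpecialLinearGroup.coe_inv, Matrix.adjugate_fin_two]

theorem SL2_ext {g h : SL(2, 𝒪[k])} (h00 : g 0 0 = h 0 0) (h01 : g 0 1 = h 0 1)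
    (h10 : g 1 0 = h 1 0) (h11 : g 1 1 = h 1 1) : g = h := by
  ext i j
  fin_cases i <;> fin_cases j <;> simp [h00, h01, h10, h11]

/-- The matrix `[a, b; q b, a]` of determinant one. -/
noncomputable def centMat (q a b : 𝒪[k]) (h : a ^ 2 = 1 + q * b ^ 2) : SL(2, 𝒪[k]) :=
  ⟨!![a, b; q * b, a], by rw [Matrix.det_fin_two_of]; linear_combination h⟩

theorem centMat_mem {u v : k} (hu : u ≠ 0) {q : 𝒪[k]} (hq : (q : k) * u = v) (a b : 𝒪[k])
    (h : a ^ 2 = 1 + q * b ^ 2) : centMat q a b h ∈ centK (antidiag u v) :=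
  (mem_centK_antidiag_iff hu hq).2 ⟨rfl, rfl⟩

theorem mem_centK_nilp_iff {u : k} (hu : u ≠ 0) {g : SL(2, 𝒪[k])} :
    g ∈ centK (antidiag u 0) ↔ g 1 1 = g 0 0 ∧ g 1 0 = 0 := by
  simpa using mem_centK_antidiag_iff hu (v := 0) (q := 0) (by simp) (g := g)

theorem nilp_sq {u : k} (hu : u ≠ 0) (t : centK (antidiag u 0)) : t.1 0 0 ^ 2 = 1 := by
  simpa using centK_sq (q := 0) (g := t.1) (by simpa using (mem_centK_nilp_iff hu).1 t.2)

theorem centK_nilp_eq {u : k} (hu : u ≠ 0) :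
    centK (antidiag u 0) = Subgroup.center SL(2, 𝒪[k]) ⊔ unipK := by
  apply le_antisymm
  · intro g hg
    obtain ⟨h1, h2⟩ := (mem_centK_nilp_iff hu).1 hg
    have hz : g 0 0 ^ 2 = 1 := nilp_sq hu ⟨g, hg⟩
    let z : SL(2, 𝒪[k]) := ⟨!![g 0 0, 0; 0, g 0 0], by
      rw [Matrix.det_fin_two_of]; linear_combination hz⟩
    -- The scalar `z = g 0 0` is its own inverse, so the unipotent part of `g` has entry `z * g 0
    -- 1`.
    let n : SL(2, 𝒪[k]) := ⟨!![1, g 0 0 * g 0 1; 0, 1], by rw [Matrix.det_fin_two_of]; ring⟩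
    have hzn : g = z * n := by
      apply SL2_ext <;> rw [SL2_mul_apply] <;> simp [z, n, h1, h2]
      linear_combination -(g 0 1) * hz
    rw [hzn]
    refine Subgroup.mul_mem_sup (Matrix.SpecialLinearGroup.mem_center_iff.2
      ⟨g 0 0, by simpa using hz, ?_⟩) ⟨_, rfl⟩
    ext i j
    fin_cases i <;> fin_cases j <;> simp [z]
  · refine sup_le (fun g hg => ?_) ?_
    · obtain ⟨r, -, hr⟩ := Matrix.SpecialLinearGroup.mem_center_iff.1 hg
      rw [mem_centK_nilp_iff hu, ← hr]
      simp
    · rintro g ⟨b, hb⟩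
      rw [mem_centK_nilp_iff hu, hb]
      simp

end Centralizer

/-! ### Existence and uniqueness of transfers. -/

section Transfer

variable {k : Type*} [Field k] [ValuativeRel k] [TopologicalSpace k]
  [IsNonarchimedeanLocalField k]

theorem isUnit_of_sq_eq {q a b : 𝒪[k]} (hq : q ∈ 𝓂[k]) (h : a ^ 2 = 1 + q * b ^ 2) :
    IsUnit a := by
  have h1 : IsUnit (a ^ 2) := isUnit_of_sub_mem isUnit_one (by
    rw [h, show 1 - (1 + q * b ^ 2) = -(b ^ 2) * q by ring]
    exact Ideal.mul_mem_left _ _ hq)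
  exact (isUnit_pow_iff two_ne_zero).1 h1

/-- Congruent diagonal entries of two elements of the centralizer differ by a multiple of the
difference of the off-diagonal ones. -/
theorem exists_sub_eq_mul (hp : ringChar 𝓀[k] ≠ 2) {q a b a' b' : 𝒪[k]} (hq : q ∈ 𝓂[k])
    (h : a ^ 2 = 1 + q * b ^ 2) (h' : a' ^ 2 = 1 + q * b' ^ 2) (haa : a - a' ∈ 𝓂[k]) :
    ∃ c, a - a' = c * (q * (b + b') * (b - b')) := by
  obtain ⟨e, he⟩ := isUnit_add_of_sub_mem hp (isUnit_of_sq_eq hq h) haa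
  refine ⟨((e⁻¹ : 𝒪[k]ˣ) : 𝒪[k]), ?_⟩
  rw [Units.eq_inv_mul_iff_mul_eq, he]
  linear_combination h - h'

theorem exists_sub_eq_mul_sq (hp : ringChar 𝓀[k] ≠ 2) {q a b z : 𝒪[k]} (hq : q ∈ 𝓂[k])
    (h : a ^ 2 = 1 + q * b ^ 2) (hz : z ^ 2 = 1) (haz : a - z ∈ 𝓂[k]) :
    ∃ c, a - z = c * (q * b ^ 2) := by
  obtain ⟨c, hc⟩ := exists_sub_eq_mul hp hq h (a' := z) (b' := 0) (by simpa using hz) haz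
  exact ⟨c, by rw [hc]; ring⟩

theorem sq_eq_one_cases (hp : ringChar 𝓀[k] ≠ 2) {z : 𝒪[k]} (hz : z ^ 2 = 1)
    (h : z - 1 ∈ 𝓂[k]) : z = 1 :=
  eq_of_sq_eq_of_sub_mem hp (IsUnit.of_mul_eq_one z (by rw [← hz, sq])) h (by simpa using hz)

theorem exists_centMat (hp : ringChar 𝓀[k] ≠ 2) {q : 𝒪[k]} (hq : q ∈ 𝓂[k]) {z : 𝒪[k]}
    (hz : z ^ 2 = 1) (b : 𝒪[k]) : ∃ a, a ^ 2 = 1 + q * b ^ 2 ∧ a - z ∈ 𝓂[k] := by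
  refine exists_sq_eq hp (IsUnit.of_mul_eq_one z (by rw [← hz, sq])) ?_
  rw [hz, show 1 - (1 + q * b ^ 2) = -(b ^ 2) * q by ring]
  exact Ideal.mul_mem_left _ _ hq

variable {u v : k} {q : 𝒪[k]}

/-- From `a² - z² = q b²` and the invertibility of `a + z` for `a ≡ z` modulo `𝓂[k]`, a congruence
modulo `𝓂[k]` improves itself to one modulo `q`, the modulus of `IsTransfer` when `v' = 0`. -/
theorem isTransfer_iff (hp : ringChar 𝓀[k] ≠ 2) (hu : u ≠ 0) (hq : (q : k) * u = v)
    (hqm : q ∈ 𝓂[k]) {t' : centK (antidiag u 0)} {t : centK (antidiag u v)} :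
    IsTransfer u v u 0 t' t ↔ t.1 0 1 = t'.1 0 1 ∧ t.1 0 0 - t'.1 0 0 ∈ 𝓂[k] := by
  have hq' : u⁻¹ * v - u⁻¹ * 0 = q := by
    rw [← hq]
    field_simp
    simp
  rw [IsTransfer, hq']
  refine and_congr_right fun h => ⟨?_, fun h' => ?_⟩
  · rintro ⟨c, hc⟩
    have : t.1 0 0 - t'.1 0 0 = c * q := Subtype.ext (by push_cast; exact hc)
    rw [this]
    exact Ideal.mul_mem_left _ _ hqm
  · obtain ⟨c, hc⟩ := exists_sub_eq_mul_sq hp hqm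
      (centK_sq ((mem_centK_antidiag_iff hu hq).1 t.2)) (nilp_sq hu t') h'
    refine ⟨c * t.1 0 1 ^ 2, ?_⟩
    have := congrArg (Subtype.val) hc
    push_cast at this ⊢
    linear_combination this

/-- The diagonal entry of the transfer must be the square root of `1 + q b²` close to `z`, which
exists by Hensel's lemma and is unique because `2` is a unit. -/
theorem existsUnique_transfer (hp : ringChar 𝓀[k] ≠ 2) (hu : u ≠ 0) (hq : (q : k) * u = v)
    (hqm : q ∈ 𝓂[k]) (t' : centK (antidiag u 0)) :
    ∃! t : centK (antidiag u v), IsTransfer u v u 0 t' t := by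
  simp only [isTransfer_iff hp hu hq hqm]
  obtain ⟨a, ha, haz⟩ := exists_centMat hp hqm (nilp_sq hu t') (t'.1 0 1)
  refine ⟨⟨centMat q a (t'.1 0 1) ha, centMat_mem hu hq _ _ _⟩, ⟨rfl, haz⟩, ?_⟩
  rintro ⟨s, hs⟩ ⟨h1, h2⟩
  have hs' := (mem_centK_antidiag_iff hu hq).1 hs
  dsimp only at h1 h2
  have hsq := centK_sq hs'
  have h00 : s 0 0 = a := by
    refine eq_of_sq_eq_of_sub_mem hp (isUnit_of_sq_eq hqm hsq) ?_ ?_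
    · simpa using sub_mem h2 haz
    · rw [hsq, h1, ha]
  refine Subtype.ext (SL2_ext h00 h1 ?_ ?_)
  · rw [hs'.2, h1]
    rfl
  · rw [hs'.1, h00]
    rfl

/-- Every element of `T(X(u, v))` is the transfer of an element of `T(X(u, 0))`. -/
theorem exists_isTransfer (hp : ringChar 𝓀[k] ≠ 2) (hu : u ≠ 0) (hq : (q : k) * u = v)
    (hqm : q ∈ 𝓂[k]) (t : centK (antidiag u v)) :
    ∃ t' : centK (antidiag u 0), IsTransfer u v u 0 t' t := by
  simp only [isTransfer_iff hp hu hq hqm]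
  have hsq := centK_sq ((mem_centK_antidiag_iff hu hq).1 t.2)
  have h : ∃ z : 𝒪[k], z ^ 2 = 1 ∧ t.1 0 0 - z ∈ 𝓂[k] := by
    have h1 : (t.1 0 0 - 1) * (t.1 0 0 + 1) ∈ 𝓂[k] := by
      rw [show (t.1 0 0 - 1) * (t.1 0 0 + 1) = t.1 0 1 ^ 2 * q by linear_combination hsq]
      exact Ideal.mul_mem_left _ _ hqm
    rcases Ideal.IsPrime.mem_or_mem inferInstance h1 with h | h
    · exact ⟨1, by simp, h⟩
    · exact ⟨-1, by simp, by simpa using h⟩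
  obtain ⟨z, hz, hz'⟩ := h
  exact ⟨⟨centMat 0 z (t.1 0 1) (by simpa using hz), centMat_mem hu (by simp) _ _ _⟩, rfl, hz'⟩

end Transfer

/-! ### The character `Ψ_X` of `segK d` and its extension by `θ`. -/

section ShalikaChar

/-- An additive character with values in the units. -/
noncomputable def unitChar {k : Type*} [Field k] (Ψ : AddChar k ℂ) : Multiplicative k →* ℂˣ :=
  Ψ.toMonoidHom.toHomUnits

theorem unitChar_coe {k : Type*} [Field k] (Ψ : AddChar k ℂ) (x : k) :
    (unitChar Ψ (Multiplicative.ofAdd x) : ℂ) = Ψ x := rfl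

variable {k : Type*} [Field k] [ValuativeRel k] {ϖ : 𝒪[k]} {Ψ : AddChar k ℂ} {u v : k} {q : 𝒪[k]}
  {d : ℕ}

theorem mem_segK {g : SL(2, 𝒪[k])} :
    g ∈ segK d ↔ g 0 0 - 1 ∈ 𝓂[k] ^ ((d + 1) / 2) ∧ g 0 1 ∈ 𝓂[k] ^ ((d + 1) / 2) ∧
      g 1 0 ∈ 𝓂[k] ^ (d / 2 + 1) ∧ g 1 1 - 1 ∈ 𝓂[k] ^ ((d + 1) / 2) := Iff.rfl

theorem mem_congK {n : ℕ} {g : SL(2, 𝒪[k])} :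
    g ∈ congK n ↔ g 0 0 - 1 ∈ 𝓂[k] ^ n ∧ g 0 1 ∈ 𝓂[k] ^ n ∧
      g 1 0 ∈ 𝓂[k] ^ n ∧ g 1 1 - 1 ∈ 𝓂[k] ^ n := by
  rw [congK, MonoidHom.mem_ker, Matrix.SpecialLinearGroup.ext_iff]
  have h1 (x : 𝒪[k]) : Ideal.Quotient.mk (𝓂[k] ^ n) x = 1 ↔ x - 1 ∈ 𝓂[k] ^ n := by
    rw [← map_one (Ideal.Quotient.mk (𝓂[k] ^ n)), Ideal.Quotient.eq]
  simp [Fin.forall_fin_two, Ideal.Quotient.eq_zero_iff_mem, h1, and_assoc]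

theorem mul_mem_pow_add {R : Type*} [CommRing R] {I : Ideal R} {x y : R} {m n : ℕ}
    (hx : x ∈ I ^ m) (hy : y ∈ I ^ n) : x * y ∈ I ^ (m + n) := by
  rw [pow_add]
  exact Ideal.mul_mem_mul hx hy

theorem addChar_eq_of_sub_mem (hΨ : ∀ x ∈ fracIdeal ϖ 1, Ψ x = 1) {x y : k}
    (h : x - y ∈ fracIdeal ϖ 1) : Ψ x = Ψ y := by
  rw [← sub_add_cancel x y, AddChar.map_add_eq_mul, hΨ _ h, one_mul]

/-- For even `d` the lower left entry must lie one power deeper than the others; the factor `q ∈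
𝓂[k]` supplies that power. -/
theorem conj_mem_segK {t g : SL(2, 𝒪[k])} (ht : t 1 1 = t 0 0 ∧ t 1 0 = q * t 0 1)
    (hqm : q ∈ 𝓂[k]) (hg : g ∈ segK d) : t * g * t⁻¹ ∈ segK d := by
  obtain ⟨h1, h2, h3, h4⟩ := mem_segK.1 hg
  have hle : 𝓂[k] ^ (d / 2 + 1) ≤ 𝓂[k] ^ ((d + 1) / 2) := Ideal.pow_le_pow_right (by omega)
  have hle' : 𝓂[k] ^ ((d + 1) / 2 + 1) ≤ 𝓂[k] ^ (d / 2 + 1) := Ideal.pow_le_pow_right (by omega)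
  have hsq := centK_sq ht
  have hq {x : 𝒪[k]} (hx : x ∈ 𝓂[k] ^ ((d + 1) / 2)) : x * q ∈ 𝓂[k] ^ (d / 2 + 1) :=
    hle' (by simpa using mul_mem_pow_add hx (by simpa using hqm : q ∈ 𝓂[k] ^ 1))
  rw [mem_segK]
  simp only [SL2_mul_apply, SL2_inv_coe, ht.1, ht.2, Matrix.of_apply, Matrix.cons_val',
    Matrix.cons_val_zero, Matrix.cons_val_one, Matrix.cons_val_fin_one]
  set a := t 0 0
  set b := t 0 1
  refine ⟨?_, ?_, ?_, ?_⟩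
  · convert! add_mem (add_mem (Ideal.mul_mem_left _ (a ^ 2) h1)
      (Ideal.mul_mem_left _ (a * b) (hle h3))) (sub_mem (Ideal.mul_mem_left _ (-(q * a * b)) h2)
      (Ideal.mul_mem_left _ (q * b ^ 2) h4)) using 1
    linear_combination hsq
  · convert! add_mem (add_mem (Ideal.mul_mem_left _ (-(a * b)) h1)
      (Ideal.mul_mem_left _ (-(b ^ 2)) (hle h3))) (add_mem (Ideal.mul_mem_left _ (a ^ 2) h2)
      (Ideal.mul_mem_left _ (a * b) h4)) using 1
    ring
  · convert! add_mem (add_mem (Ideal.mul_mem_left _ (a * b) (hq h1))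
      (Ideal.mul_mem_left _ (a ^ 2) h3)) (add_mem (Ideal.mul_mem_left _ (-(q * b ^ 2)) (hq h2))
      (Ideal.mul_mem_left _ (-(a * b)) (hq h4))) using 1
    ring
  · convert! add_mem (add_mem (Ideal.mul_mem_left _ (-(q * b ^ 2)) h1)
      (Ideal.mul_mem_left _ (-(a * b)) (hle h3))) (add_mem (Ideal.mul_mem_left _ (q * a * b) h2)
      (Ideal.mul_mem_left _ (a ^ 2) h4)) using 1
    linear_combination hsq

/-- Conjugation by `t` fixes `X`, hence preserves `Tr(X(g - I))`. -/
theorem psi_conj_eq (hq : (q : k) * u = v) {t g : SL(2, 𝒪[k])}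
    (ht : t 1 1 = t 0 0 ∧ t 1 0 = q * t 0 1) :
    u * ((t * g * t⁻¹) 1 0 : 𝒪[k]) + v * ((t * g * t⁻¹) 0 1 : 𝒪[k])
      = u * (g 1 0 : 𝒪[k]) + v * (g 0 1 : 𝒪[k]) := by
  have hsq := congrArg Subtype.val (centK_sq ht)
  simp only [SL2_mul_apply, SL2_inv_coe, ht.1, ht.2, Matrix.of_apply, Matrix.cons_val',
    Matrix.cons_val_zero, Matrix.cons_val_one, Matrix.cons_val_fin_one, ← hq]
  push_cast at hsq ⊢
  linear_combination u * ((g 1 0 : 𝒪[k]) + q * (g 0 1 : 𝒪[k])) * hsq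

theorem shalikaChar_eq {X : Matrix (Fin 2) (Fin 2) k} {θ : centK X →* ℂˣ}
    {χ : shalikaGroup d X →* ℂˣ} (h : IsShalikaChar Ψ d X θ χ) : shalikaChar Ψ d X θ = χ := by
  have hex : ∃ χ, IsShalikaChar Ψ d X θ χ := ⟨χ, h⟩
  rw [shalikaChar, dif_pos hex]
  exact hex.choose_spec.unique h

variable [TopologicalSpace k] [IsNonarchimedeanLocalField k]

theorem mul_coe_mem_fracIdeal (hϖ : Irreducible ϖ) {x : k} {m : ℤ} (hx : x ∈ fracIdeal ϖ m)
    {c : 𝒪[k]} {n : ℕ} (hc : c ∈ 𝓂[k] ^ n) : x * c ∈ fracIdeal ϖ (m + n) :=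
  mul_mem_fracIdeal hϖ hx ((mem_maximalIdeal_pow_iff hϖ).1 hc)

/-- Additivity fails only by cross terms. Those with `u` have valuation at least `-d + (d/2 + 1) +
(d + 1)/2 = 1` (natural division), those with `v` at least `(-d + 1) + 2⌈d/2⌉ ≥ 1`. -/
theorem psi_segK_mul (hϖ : Irreducible ϖ) (hΨ : ∀ x ∈ fracIdeal ϖ 1, Ψ x = 1)
    (hX : IsShalikaElement ϖ d u v) {g h : SL(2, 𝒪[k])} (hg : g ∈ segK d) (hh : h ∈ segK d) :
    Ψ (u * ((g * h) 1 0 : 𝒪[k]) + v * ((g * h) 0 1 : 𝒪[k])) =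
      Ψ (u * (g 1 0 : 𝒪[k]) + v * (g 0 1 : 𝒪[k])) *
        Ψ (u * (h 1 0 : 𝒪[k]) + v * (h 0 1 : 𝒪[k])) := by
  obtain ⟨h1, h2, h3, h4⟩ := mem_segK.1 hg
  obtain ⟨h1', h2', h3', h4'⟩ := mem_segK.1 hh
  rw [← AddChar.map_add_eq_mul]
  apply addChar_eq_of_sub_mem hΨ
  have e1 := fracIdeal_anti hϖ (m := 1) (by push_cast; omega)
    (mul_coe_mem_fracIdeal hϖ hX.2.1.mem (mul_mem_pow_add h3 h1'))
  have e2 := fracIdeal_anti hϖ (m := 1) (by push_cast; omega)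
    (mul_coe_mem_fracIdeal hϖ hX.2.1.mem (mul_mem_pow_add h3' h4))
  have e3 := fracIdeal_anti hϖ (m := 1) (by push_cast; omega)
    (mul_coe_mem_fracIdeal hϖ hX.2.2 (mul_mem_pow_add h2' h1))
  have e4 := fracIdeal_anti hϖ (m := 1) (by push_cast; omega)
    (mul_coe_mem_fracIdeal hϖ hX.2.2 (mul_mem_pow_add h2 h4'))
  convert! add_mem (add_mem e1 e2) (add_mem e3 e4) using 1
  simp only [SL2_mul_apply]
  push_cast
  ring

theorem exists_shalikaChar (hϖ : Irreducible ϖ) (hΨ : ∀ x ∈ fracIdeal ϖ 1, Ψ x = 1)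
    (hX : IsShalikaElement ϖ d u v) (hq : (q : k) * u = v) (hqm : q ∈ 𝓂[k])
    (θ : centK (antidiag u v) →* ℂˣ)
    (hθ : ∀ t : centK (antidiag u v), t.1 ∈ segK d → (θ t : ℂ) = psiTr Ψ (antidiag u v) (incl t.1)) :
    ∃ χ, IsShalikaChar Ψ d (antidiag u v) θ χ := by
  have hu : u ≠ 0 := hX.2.1.ne_zero
  let ψ : segK d →* ℂˣ := MonoidHom.mk'
    (fun g => unitChar Ψ (Multiplicative.ofAdd
      (u * (g.1 1 0 : 𝒪[k]) + v * (g.1 0 1 : 𝒪[k]))))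
    (fun g h => Units.ext (psi_segK_mul hϖ hΨ hX g.2 h.2))
  have hψ (g : segK d) : (ψ g : ℂ) = psiTr Ψ (antidiag u v) (incl g.1) := by
    rw [psiTr_antidiag]
    rfl
  obtain ⟨χ, h1, h2⟩ := exists_char_sup θ ψ
    (fun t ht g hg => conj_mem_segK ((mem_centK_antidiag_iff hu hq).1 ht) hqm hg)
    (fun t ht g hg => by
      apply Units.ext
      rw [hψ, hψ, psiTr_antidiag, psiTr_antidiag,
        psi_conj_eq hq ((mem_centK_antidiag_iff hu hq).1 ht)])
    (fun g hA hB => Units.ext (by rw [hθ ⟨g, hA⟩ hB, hψ]))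
  exact ⟨χ, h1, fun g hg => by rw [← hψ ⟨g, hg⟩, ← h2 g hg]; rfl⟩

end ShalikaChar

/-! ### Passing from `X(u, v)` to `X(u, 0)`. -/

section Degeneration

variable {k : Type*} [Field k] [ValuativeRel k] [TopologicalSpace k]
  [IsNonarchimedeanLocalField k] {ϖ : 𝒪[k]} {Ψ : AddChar k ℂ} {u v : k} {q : 𝒪[k]} {d : ℕ} {V : ℤ}

theorem coe_quotient_mem (hϖ : Irreducible ϖ) (hu : HasVal ϖ u (-d)) (hv : HasVal ϖ v V)
    (hq : (q : k) * u = v) : (q : k) ∈ fracIdeal ϖ (d + V) := by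
  apply mem_fracIdeal_of_mul_mem hϖ hu
  rw [mul_comm, hq]
  exact fracIdeal_anti hϖ (by omega) hv.mem

theorem exists_quotient (hϖ : Irreducible ϖ) (hu : HasVal ϖ u (-d)) (hv : HasVal ϖ v V)
    (h : 0 ≤ d + V) : ∃ q : 𝒪[k], (q : k) * u = v := by
  have h1 : v * u⁻¹ ∈ fracIdeal ϖ 0 :=
    fracIdeal_anti hϖ (by omega) (mul_mem_fracIdeal hϖ hv.mem (hu.inv hϖ).mem)
  obtain ⟨c, hc⟩ := mem_fracIdeal_iff.1 h1
  refine ⟨c, ?_⟩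
  rw [zpow_zero, mul_one] at hc
  rw [← hc, inv_mul_cancel_right₀ hu.ne_zero]

/-- The character `θ` of `T(X(u, v))` is given by `Ψ` near the identity; for `θ = φ^μ` this is what
remains of the hypothesis that `Γ` represents `φ`. -/
def IsNearIdentity (Ψ : AddChar k ℂ) (ϖ : 𝒪[k]) (d : ℕ) (V : ℤ) (u v : k)
    (θ : centK (antidiag u v) →* ℂˣ) : Prop :=
  ∀ (t : centK (antidiag u v)) (m : ℤ), t.1 0 0 - 1 ∈ 𝓂[k] →
    ((t.1 0 1 : 𝒪[k]) : k) ∈ fracIdeal ϖ m → 0 < 4 * m + d + 3 * V →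
    (θ t : ℂ) = Ψ (2 * (t.1 0 1 : 𝒪[k]) * v)

variable {θ : centK (antidiag u v) →* ℂˣ}

/-- The off-diagonal entry of `t s⁻¹` is a multiple of the difference of those of `t` and `s`. So
the hypothesis on `θ` applies to `t s⁻¹`, as `4j + d + 3V = 4(j + V) + (d - V) > 0`, and its value
is `1` because `j + V ≥ 1`. -/
theorem IsNearIdentity.eq_of_close (hθ : IsNearIdentity Ψ ϖ d V u v θ)
    (hp : ringChar 𝓀[k] ≠ 2) (hϖ : Irreducible ϖ) (hΨ : ∀ x ∈ fracIdeal ϖ 1, Ψ x = 1)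
    (hu : u ≠ 0) (hv : HasVal ϖ v V) (hq : (q : k) * u = v) (hqm : q ∈ 𝓂[k]) (hV : V < d)
    {t s : centK (antidiag u v)} (h00 : t.1 0 0 - s.1 0 0 ∈ 𝓂[k]) {j : ℤ}
    (h01 : ((t.1 0 1 - s.1 0 1 : 𝒪[k]) : k) ∈ fracIdeal ϖ j) (hj : 0 < j + V) : θ t = θ s := by
  have ht := (mem_centK_antidiag_iff hu hq).1 t.2
  have hs := (mem_centK_antidiag_iff hu hq).1 s.2
  obtain ⟨c, hc⟩ := exists_sub_eq_mul hp hqm (centK_sq ht) (centK_sq hs) h00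
  have hsq := centK_sq hs
  rw [← mul_inv_eq_one, ← map_inv, ← map_mul]
  have e00 : (t * s⁻¹).1 0 0 - 1 = (t.1 0 0 - s.1 0 0) * s.1 0 0
      + (s.1 0 1 ^ 2 - t.1 0 1 * s.1 0 1) * q := by
    simp only [Subgroup.coe_mul, Subgroup.coe_inv, SL2_mul_apply, SL2_inv_coe, hs.1, hs.2,
      Matrix.of_apply, Matrix.cons_val', Matrix.cons_val_zero, Matrix.cons_val_one,
      Matrix.cons_val_fin_one]
    linear_combination hsq
  have e01 : (t * s⁻¹).1 0 1 = (s.1 0 0 - s.1 0 1 * (c * (q * (t.1 0 1 + s.1 0 1))))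
      * (t.1 0 1 - s.1 0 1) := by
    simp only [Subgroup.coe_mul, Subgroup.coe_inv, SL2_mul_apply, SL2_inv_coe, hs.1, hs.2,
      Matrix.of_apply, Matrix.cons_val', Matrix.cons_val_zero, Matrix.cons_val_one,
      Matrix.cons_val_fin_one]
    linear_combination -(s.1 0 1) * hc
  have hmem : (((t * s⁻¹).1 0 1 : 𝒪[k]) : k) ∈ fracIdeal ϖ j := by
    rw [e01]
    exact coe_mul_mem_fracIdeal hϖ _ h01
  apply Units.ext
  rw [hθ (t * s⁻¹) j ?_ hmem (by omega), Units.val_one]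
  · apply hΨ
    have := coe_mul_mem_fracIdeal hϖ 2 (mul_mem_fracIdeal hϖ hmem hv.mem)
    rw [mul_assoc]
    exact fracIdeal_anti hϖ (by omega) this
  · rw [e00]
    exact add_mem (Ideal.mul_mem_right _ _ h00) (Ideal.mul_mem_left _ _ hqm)

/-- `θ'` is the character of `T(X(u, 0))` given by `θ'(t') = θ(t) Ψ(z b v)⁻¹`, for `t` the transfer of
`t' = t(z, b)`. -/
def IsDegeneration (Ψ : AddChar k ℂ) (u v : k) (θ : centK (antidiag u v) →* ℂˣ)
    (θ' : centK (antidiag u 0) →* ℂˣ) : Prop :=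
  ∀ (t' : centK (antidiag u 0)) (t : centK (antidiag u v)), IsTransfer u v u 0 t' t →
    (θ' t' : ℂ) = (θ t : ℂ) * (Ψ (((t'.1 0 0 : 𝒪[k]) : k) * (t'.1 0 1 : 𝒪[k]) * v))⁻¹

/-- Transfer is not multiplicative, but the off-diagonal entries of `w` and `t s` differ by a
multiple of `q`, hence by an element of `𝒫^(d+V)`. Since `(d + V) + V > 0`, `θ` does not see the
difference. -/
theorem IsNearIdentity.map_transfer_mul (hθ : IsNearIdentity Ψ ϖ d V u v θ)
    (hp : ringChar 𝓀[k] ≠ 2) (hϖ : Irreducible ϖ) (hΨ : ∀ x ∈ fracIdeal ϖ 1, Ψ x = 1)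
    (hu : HasVal ϖ u (-d)) (hv : HasVal ϖ v V) (hq : (q : k) * u = v) (hqm : q ∈ 𝓂[k])
    (hV : V < d) (hdV : 0 < d + 2 * V)
    {t' s' : centK (antidiag u 0)} {t s w : centK (antidiag u v)} (ht : IsTransfer u v u 0 t' t)
    (hs : IsTransfer u v u 0 s' s) (hw : IsTransfer u v u 0 (t' * s') w) :
    θ w = θ t * θ s := by
  have hu0 := hu.ne_zero
  rw [isTransfer_iff hp hu0 hq hqm] at ht hs hw
  have cs := (mem_centK_antidiag_iff hu0 hq).1 s.2
  have cs' := (mem_centK_nilp_iff hu0).1 s'.2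
  obtain ⟨c, hc⟩ := exists_sub_eq_mul_sq hp hqm
    (centK_sq ((mem_centK_antidiag_iff hu0 hq).1 t.2)) (nilp_sq hu0 t') ht.2
  obtain ⟨e, he⟩ := exists_sub_eq_mul_sq hp hqm (centK_sq cs) (nilp_sq hu0 s') hs.2
  rw [← map_mul]
  have e00 : (t * s).1 0 0 = t.1 0 0 * s.1 0 0 + t.1 0 1 * s.1 0 1 * q := by
    rw [Subgroup.coe_mul, SL2_mul_apply, cs.2]
    ring
  have e01 : (t * s).1 0 1 = t.1 0 0 * s.1 0 1 + t.1 0 1 * s.1 0 0 := by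
    rw [Subgroup.coe_mul, SL2_mul_apply, cs.1]
  have e00' : (t' * s').1 0 0 = t'.1 0 0 * s'.1 0 0 := by
    rw [Subgroup.coe_mul, SL2_mul_apply, cs'.2]
    ring
  have e01' : (t' * s').1 0 1 = t'.1 0 0 * s.1 0 1 + t.1 0 1 * s'.1 0 0 := by
    rw [Subgroup.coe_mul, SL2_mul_apply, cs'.1, hs.1, ht.1]
  refine hθ.eq_of_close hp hϖ hΨ hu0 hv hq hqm hV (j := d + V) ?_ ?_ (by omega)
  · convert! sub_mem hw.2 (add_mem (add_mem (Ideal.mul_mem_left _ (s.1 0 0) ht.2)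
      (Ideal.mul_mem_left _ (t'.1 0 0) hs.2)) (Ideal.mul_mem_left _ (t.1 0 1 * s.1 0 1) hqm)) using 1
    rw [e00, e00']
    ring
  · rw [hw.1, e01, e01', show t'.1 0 0 * s.1 0 1 + t.1 0 1 * s'.1 0 0
      - (t.1 0 0 * s.1 0 1 + t.1 0 1 * s.1 0 0)
      = (-(s.1 0 1) * (c * t.1 0 1 ^ 2) - t.1 0 1 * (e * s.1 0 1 ^ 2)) * q by
        linear_combination -(s.1 0 1) * hc - t.1 0 1 * he]
    exact coe_mul_mem_fracIdeal hϖ _ (coe_quotient_mem hϖ hu hv hq)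

theorem IsNearIdentity.exists_isDegeneration (hθ : IsNearIdentity Ψ ϖ d V u v θ)
    (hp : ringChar 𝓀[k] ≠ 2) (hϖ : Irreducible ϖ) (hΨ : ∀ x ∈ fracIdeal ϖ 1, Ψ x = 1)
    (hu : HasVal ϖ u (-d)) (hv : HasVal ϖ v V) (hq : (q : k) * u = v) (hqm : q ∈ 𝓂[k])
    (hV : V < d) (hdV : 0 < d + 2 * V) : ∃ θ', IsDegeneration Ψ u v θ θ' := by
  have hu0 := hu.ne_zero
  choose tr htr huniq using existsUnique_transfer hp hu0 hq hqm
  refine ⟨MonoidHom.mk' (fun t' => θ (tr t') * (unitChar Ψ (Multiplicative.ofAdd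
    (((t'.1 0 0 : 𝒪[k]) : k) * (t'.1 0 1 : 𝒪[k]) * v)))⁻¹) fun t' s' => ?_, fun t' t h => ?_⟩
  -- Because `z² = 1`, the map `t(z, b) ↦ z b` is additive, so the twisting factor is a character of
  -- `Z U`.
  · have h1 : (((t' * s').1 0 0 : 𝒪[k]) : k) * ((t' * s').1 0 1 : 𝒪[k]) * v
        = ((t'.1 0 0 : 𝒪[k]) : k) * (t'.1 0 1 : 𝒪[k]) * v
          + ((s'.1 0 0 : 𝒪[k]) : k) * (s'.1 0 1 : 𝒪[k]) * v := by
      have cs' := (mem_centK_nilp_iff hu0).1 s'.2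
      have hz := congrArg Subtype.val (nilp_sq hu0 t')
      have hz' := congrArg Subtype.val (nilp_sq hu0 s')
      rw [Subgroup.coe_mul, SL2_mul_apply, SL2_mul_apply, cs'.2, cs'.1]
      push_cast at hz hz' ⊢
      linear_combination ((s'.1 0 0 : 𝒪[k]) : k) * (s'.1 0 1 : 𝒪[k]) * v * hz
        + ((t'.1 0 0 : 𝒪[k]) : k) * (t'.1 0 1 : 𝒪[k]) * v * hz'
    rw [hθ.map_transfer_mul hp hϖ hΨ hu hv hq hqm hV hdV (htr t') (htr s') (htr (t' * s')), h1,
      ofAdd_add, map_mul, mul_inv, mul_mul_mul_comm]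
  · rw [huniq t' t h, MonoidHom.mk'_apply, Units.val_mul, Units.val_inv_eq_inv_val, unitChar_coe]

variable {θ' : centK (antidiag u 0) →* ℂˣ}

/-- Near the identity, a degeneration is given by `Ψ(b v)`. -/
theorem IsDegeneration.apply_eq (hθ' : IsDegeneration Ψ u v θ θ')
    (hθ : IsNearIdentity Ψ ϖ d V u v θ) (hp : ringChar 𝓀[k] ≠ 2) (hu : u ≠ 0)
    (hq : (q : k) * u = v) (hqm : q ∈ 𝓂[k]) (t' : centK (antidiag u 0))
    (h00 : t'.1 0 0 - 1 ∈ 𝓂[k]) {m : ℤ} (h01 : ((t'.1 0 1 : 𝒪[k]) : k) ∈ fracIdeal ϖ m)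
    (hm : 0 < 4 * m + d + 3 * V) : (θ' t' : ℂ) = Ψ ((t'.1 0 1 : 𝒪[k]) * v) := by
  obtain ⟨t, ht, -⟩ := existsUnique_transfer hp hu hq hqm t'
  have ht' := (isTransfer_iff hp hu hq hqm).1 ht
  have hz := sq_eq_one_cases hp (nilp_sq hu t') h00
  rw [hθ' t' t ht, hθ t m (by simpa [hz] using ht'.2) (ht'.1 ▸ h01) hm, ht'.1, hz,
    ← AddChar.map_neg_eq_inv, ← AddChar.map_add_eq_mul]
  congr 1
  push_cast
  ring

/-- Every entry of `t'⁻¹ t - 1` is a multiple of `q`. The exact lower left entry is recorded because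
multiplying it by `u` gives `z b v`, the argument of the correcting factor in `θ'`. -/
theorem IsTransfer.inv_mul_mem_segK (hp : ringChar 𝓀[k] ≠ 2) (hu : u ≠ 0)
    (hq : (q : k) * u = v) (hqm : q ∈ 𝓂[k]) (hqd : q ∈ 𝓂[k] ^ (d / 2 + 1))
    {t' : centK (antidiag u 0)} {t : centK (antidiag u v)} (h : IsTransfer u v u 0 t' t) :
    t'.1⁻¹ * t.1 ∈ segK d ∧ (t'.1⁻¹ * t.1) 1 0 = t'.1 0 0 * t'.1 0 1 * q := by
  rw [isTransfer_iff hp hu hq hqm] at h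
  have ct := (mem_centK_antidiag_iff hu hq).1 t.2
  have ct' := (mem_centK_nilp_iff hu).1 t'.2
  have hz := nilp_sq hu t'
  obtain ⟨c, hc⟩ := exists_sub_eq_mul_sq hp hqm (centK_sq ct) hz h.2
  have hle : 𝓂[k] ^ (d / 2 + 1) ≤ 𝓂[k] ^ ((d + 1) / 2) := Ideal.pow_le_pow_right (by omega)
  have hm (x : 𝒪[k]) : x * q ∈ 𝓂[k] ^ ((d + 1) / 2) := hle (Ideal.mul_mem_left _ _ hqd)
  rw [mem_segK]
  simp only [SL2_mul_apply, SL2_inv_coe, ct.1, ct.2, ct'.1, ct'.2, h.1, Matrix.of_apply,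
    Matrix.cons_val', Matrix.cons_val_zero, Matrix.cons_val_one, Matrix.cons_val_fin_one] at hc ⊢
  set z := t'.1 0 0
  set b := t'.1 0 1
  refine ⟨⟨?_, ?_, ?_, ?_⟩, ?_⟩
  · convert! hm (z * c * b ^ 2 - b ^ 2) using 1
    linear_combination z * hc + hz
  · convert! hm (-(b * c * b ^ 2)) using 1
    linear_combination -b * hc
  · convert! Ideal.mul_mem_left _ (z * b) hqd using 1
    ring
  · convert! hm (z * c * b ^ 2) using 1
    linear_combination z * hc + hz
  · ring

theorem shalikaGroup_eq (hp : ringChar 𝓀[k] ≠ 2) (hu : u ≠ 0) (hq : (q : k) * u = v)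
    (hqm : q ∈ 𝓂[k]) (hqd : q ∈ 𝓂[k] ^ (d / 2 + 1)) :
    shalikaGroup d (antidiag u v) = shalikaGroup d (antidiag u 0) := by
  apply le_antisymm <;> refine sup_le (fun g hg => ?_) le_sup_right
  · obtain ⟨t', ht'⟩ := exists_isTransfer hp hu hq hqm ⟨g, hg⟩
    have h := (ht'.inv_mul_mem_segK hp hu hq hqm hqd).1
    rw [← mul_inv_cancel_left t'.1 g]
    exact Subgroup.mul_mem_sup t'.2 h
  · obtain ⟨t, ht, -⟩ := existsUnique_transfer hp hu hq hqm ⟨g, hg⟩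
    have h := (ht.inv_mul_mem_segK hp hu hq hqm hqd).1
    have := Subgroup.mul_mem_sup t.2 (inv_mem h)
    rw [_root_.mul_inv_rev, inv_inv, mul_inv_cancel_left] at this
    exact this

/-- The product has valuation at least `V + ⌈d/2⌉ ≥ 1`; therefore `Ψ_X` on `segK d` does not depend
on `v`. -/
theorem psi_mul_eq_one (hϖ : Irreducible ϖ) (hΨ : ∀ x ∈ fracIdeal ϖ 1, Ψ x = 1)
    (hv : HasVal ϖ v V) (hdV : 0 < d + 2 * V) {b : 𝒪[k]} (hb : b ∈ 𝓂[k] ^ ((d + 1) / 2)) :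
    Ψ (v * b) = 1 := by
  apply hΨ
  exact fracIdeal_anti hϖ (by push_cast; omega) (mul_coe_mem_fracIdeal hϖ hv.mem hb)

theorem IsDegeneration.isShalikaChar (hθ' : IsDegeneration Ψ u v θ θ')
    (hp : ringChar 𝓀[k] ≠ 2) (hϖ : Irreducible ϖ)
    (hΨ : ∀ x ∈ fracIdeal ϖ 1, Ψ x = 1) (hu : u ≠ 0) (hv : HasVal ϖ v V)
    (hq : (q : k) * u = v) (hqm : q ∈ 𝓂[k]) (hqd : q ∈ 𝓂[k] ^ (d / 2 + 1)) (hdV : 0 < d + 2 * V)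
    {χ : shalikaGroup d (antidiag u v) →* ℂˣ} (hχ : IsShalikaChar Ψ d (antidiag u v) θ χ) :
    IsShalikaChar Ψ d (antidiag u 0) θ'
      (χ.comp (Subgroup.inclusion (shalikaGroup_eq hp hu hq hqm hqd).ge)) := by
  constructor
  · intro g hg
    obtain ⟨t, ht, -⟩ := existsUnique_transfer hp hu hq hqm ⟨g, hg⟩
    obtain ⟨hs, h10⟩ := ht.inv_mul_mem_segK hp hu hq hqm hqd
    -- Evaluate `χ` on `t = g (g⁻¹ t)`, where the second factor lies in `segK d`.
    have h1 : χ ⟨t.1, (le_sup_left : centK (antidiag u v) ≤ _) t.2⟩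
        = χ ⟨g, (shalikaGroup_eq hp hu hq hqm hqd).ge ((le_sup_left : centK _ ≤ _) hg)⟩
          * χ ⟨_, (le_sup_right : segK d ≤ _) hs⟩ := by
      rw [← map_mul]
      congr 1
      exact Subtype.ext (mul_inv_cancel_left g t.1).symm
    have h2 := hχ.2 _ hs
    have h3 : Ψ (u * ((g⁻¹ * t.1) 1 0 : 𝒪[k]) + v * ((g⁻¹ * t.1) 0 1 : 𝒪[k]))
        = Ψ (((g 0 0 : 𝒪[k]) : k) * (g 0 1 : 𝒪[k]) * v) := by
      rw [AddChar.map_add_eq_mul, psi_mul_eq_one hϖ hΨ hv hdV (mem_segK.1 hs).2.1, mul_one, h10]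
      congr 1
      rw [← hq]
      push_cast
      ring
    rw [psiTr_antidiag, h3] at h2
    rw [hχ.1 t.1 t.2, Subtype.coe_eta] at h1
    apply Units.ext
    rw [hθ' _ t ht, h1, Units.val_mul, h2, mul_assoc, mul_inv_cancel₀, mul_one]
    · rfl
    · rw [← h2]
      exact Units.ne_zero _
  · intro g hg
    have h := hχ.2 g hg
    rw [psiTr_antidiag, AddChar.map_add_eq_mul, psi_mul_eq_one hϖ hΨ hv hdV (mem_segK.1 hg).2.1,
      mul_one] at h
    rw [psiTr_antidiag, zero_mul, add_zero, ← h]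
    rfl

theorem IsDegeneration.nonempty_equiv (hθ' : IsDegeneration Ψ u v θ θ')
    (hp : ringChar 𝓀[k] ≠ 2) (hϖ : Irreducible ϖ)
    (hΨ : ∀ x ∈ fracIdeal ϖ 1, Ψ x = 1) (hu : u ≠ 0) (hv : HasVal ϖ v V)
    (hq : (q : k) * u = v) (hqm : q ∈ 𝓂[k]) (hqd : q ∈ 𝓂[k] ^ (d / 2 + 1)) (hdV : 0 < d + 2 * V)
    {χ : shalikaGroup d (antidiag u v) →* ℂˣ} (hχ : IsShalikaChar Ψ d (antidiag u v) θ χ) :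
    Nonempty ((shalikaRep Ψ d (antidiag u v) θ).Equiv (shalikaRep Ψ d (antidiag u 0) θ')) := by
  refine nonempty_ind_equiv (shalikaGroup_eq hp hu hq hqm hqd) fun g hg hg' => ?_
  rw [shalikaChar_eq hχ,
    shalikaChar_eq (hθ'.isShalikaChar hp hϖ hΨ hu hv hq hqm hqd hdV hχ)]
  rfl

theorem IsDegeneration.isShalikaDatum (hθ' : IsDegeneration Ψ u v θ θ')
    (hp : ringChar 𝓀[k] ≠ 2) (hϖ : Irreducible ϖ)
    (hΨ : ∀ x ∈ fracIdeal ϖ 1, Ψ x = 1) (hu : HasVal ϖ u (-d)) (hd : 0 < d) (hv : HasVal ϖ v V)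
    (hq : (q : k) * u = v) (hqm : q ∈ 𝓂[k]) (hqd : q ∈ 𝓂[k] ^ (d / 2 + 1)) (hdV : 0 < d + 2 * V)
    {χ : shalikaGroup d (antidiag u v) →* ℂˣ} (hχ : IsShalikaChar Ψ d (antidiag u v) θ χ) :
    IsShalikaDatum Ψ ϖ d u 0 θ' := by
  have h := hθ'.isShalikaChar hp hϖ hΨ hu.ne_zero hv hq hqm hqd hdV hχ
  refine ⟨⟨hd, hu, zero_mem _⟩, fun t ht => ?_, _, h⟩
  have h1 := h.1 t.1 t.2
  rw [Subtype.coe_eta] at h1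
  rw [← h1, h.2 t.1 ht]

theorem IsNearIdentity.isShalikaDatum (hθ : IsNearIdentity Ψ ϖ d V u v θ)
    (hϖ : Irreducible ϖ) (hΨ : ∀ x ∈ fracIdeal ϖ 1, Ψ x = 1)
    (hu : HasVal ϖ u (-d)) (hd : 0 < d) (hv : HasVal ϖ v V) (hq : (q : k) * u = v)
    (hqm : q ∈ 𝓂[k]) (hdV : 0 < d + V) :
    IsShalikaDatum Ψ ϖ d u v θ := by
  have hX : IsShalikaElement ϖ d u v := ⟨hd, hu, fracIdeal_anti hϖ (by omega) hv.mem⟩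
  have hag : ∀ t : centK (antidiag u v), t.1 ∈ segK d →
      (θ t : ℂ) = psiTr Ψ (antidiag u v) (incl t.1) := by
    intro t ht
    obtain ⟨h1, h2, -, -⟩ := mem_segK.1 ht
    -- Here `m = ⌈d/2⌉`, so `4m + d + 3V ≥ 3(d + V) > 0`; on `T(X)` the trace is `u q b + v b = 2 b
    -- v`.
    rw [hθ t _ (Ideal.pow_le_self (by omega) h1) ((mem_maximalIdeal_pow_iff hϖ).1 h2)
      (by push_cast; omega), psiTr_antidiag, ((mem_centK_antidiag_iff hu.ne_zero hq).1 t.2).2]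
    congr 1
    push_cast
    linear_combination -((t.1 0 1 : 𝒪[k]) : k) * hq
  exact ⟨hX, hag, exists_shalikaChar hϖ hΨ hX hq hqm θ hag⟩

theorem IsDegeneration.charHasDepth (hθ' : IsDegeneration Ψ u v θ θ')
    (hθ : IsNearIdentity Ψ ϖ d V u v θ) (hp : ringChar 𝓀[k] ≠ 2) (hϖ : Irreducible ϖ)
    (hΨ : ∀ x ∈ fracIdeal ϖ 1, Ψ x = 1) (hΨ' : ∃ x : 𝒪[k], Ψ (x : k) ≠ 1) (hu : u ≠ 0)
    (hv : HasVal ϖ v V) (hq : (q : k) * u = v) (hqm : q ∈ 𝓂[k]) (hV : V < d) {n : ℕ}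
    (hn : (n : ℤ) = -V) : CharHasDepth (centK (antidiag u 0)) θ' n := by
  refine ⟨⟨Nat.cast_nonneg n, fun t ht => ?_⟩, fun ρ hρ => ?_⟩
  · rw [Nat.floor_natCast, mem_congK] at ht
    obtain ⟨h1, h2, -, -⟩ := ht
    have h2' := (mem_maximalIdeal_pow_iff hϖ).1 h2
    apply Units.ext
    rw [hθ'.apply_eq hθ hp hu hq hqm t (Ideal.pow_le_self (by omega) h1) h2' (by push_cast; omega)]
    exact hΨ _ (fracIdeal_anti hϖ (by push_cast; omega) (mul_mem_fracIdeal hϖ h2' hv.mem))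
  · obtain ⟨h0, h⟩ := hρ
    by_contra! hlt
    have hfl : ⌊ρ⌋₊ + 1 ≤ n := Nat.succ_le_of_lt ((Nat.floor_lt h0).2 hlt)
    -- The unipotent element with `b = x v⁻¹ ∈ 𝒫^n` detects the depth: `θ'` takes the value `Ψ x ≠
    -- 1` on it. The formula near the identity applies with `m = n = -V`, where `4m + d + 3V = d - V
    -- > 0`.
    obtain ⟨x, hx⟩ := hΨ'
    have hmem : (x : k) * v⁻¹ ∈ fracIdeal ϖ n := by
      rw [hn]
      exact coe_mul_mem_fracIdeal hϖ x (hv.inv hϖ).mem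
    obtain ⟨b, hb⟩ : ∃ b : 𝒪[k], (b : k) = x * v⁻¹ := by
      obtain ⟨c, hc⟩ := mem_fracIdeal_iff.1 hmem
      exact ⟨c * ϖ ^ n, by rw [hc]; push_cast; rw [zpow_natCast]⟩
    rw [← hb] at hmem
    let t : centK (antidiag u 0) :=
      ⟨centMat 0 1 b (by ring), centMat_mem hu (by simp) _ _ _⟩
    have ht00 : t.1 0 0 = 1 := rfl
    have ht01 : t.1 0 1 = b := rfl
    have ht : t.1 ∈ congK (⌊ρ⌋₊ + 1) := by
      obtain ⟨h11, h10⟩ := (mem_centK_nilp_iff hu).1 t.2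
      rw [mem_congK, h11, h10, ht00, ht01, sub_self]
      exact ⟨zero_mem _, Ideal.pow_le_pow_right hfl ((mem_maximalIdeal_pow_iff hϖ).2 hmem),
        zero_mem _, zero_mem _⟩
    have h1 := hθ'.apply_eq hθ hp hu hq hqm t (by simp [ht00]) (ht01 ▸ hmem) (by omega)
    rw [h t ht, ht01, hb, inv_mul_cancel_right₀ hv.ne_zero, Units.val_one] at h1
    exact hx h1.symm

/-- For `V > 0` the formula near the identity holds already with `m = 0`, that is, on all of `U`,
and `b v ∈ 𝒫`. -/
theorem IsDegeneration.apply_unipK (hθ' : IsDegeneration Ψ u v θ θ')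
    (hθ : IsNearIdentity Ψ ϖ d V u v θ) (hp : ringChar 𝓀[k] ≠ 2) (hϖ : Irreducible ϖ)
    (hΨ : ∀ x ∈ fracIdeal ϖ 1, Ψ x = 1) (hu : u ≠ 0)
    (hv : HasVal ϖ v V) (hq : (q : k) * u = v) (hqm : q ∈ 𝓂[k]) (hV : 0 < V)
    (t' : centK (antidiag u 0)) (ht' : t'.1 ∈ unipK) : θ' t' = 1 := by
  obtain ⟨b, hb⟩ := ht'
  have h0 := coe_mem_fracIdeal_zero (ϖ := ϖ) (t'.1 0 1)
  apply Units.ext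
  rw [hθ'.apply_eq hθ hp hu hq hqm t' (by simp [hb]) h0 (by omega)]
  exact hΨ _ (fracIdeal_anti hϖ (by omega) (mul_mem_fracIdeal hϖ h0 hv.mem))

end Degeneration

/-! ### Conjugation of antidiagonal matrices by `w`, `α^t`, `e` and `e^η`. -/

section Conjugation

variable {k : Type*} [Field k]

theorem conj_eq_of_mul_eq {g : SL(2, k)} {Y Z : Matrix (Fin 2) (Fin 2) k}
    (h : g.1 * Y = Z * g.1) : conj g Y = Z := by
  have h1 : g.1 * (g⁻¹ : SL(2, k)).1 = 1 := by
    rw [← Matrix.SpecialLinearGroup.coe_mul]; simp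
  rw [conj]
  exact (congrArg (· * _) h).trans (by rw [mul_assoc, h1, mul_one])

theorem conj_mul (g h : SL(2, k)) (Y : Matrix (Fin 2) (Fin 2) k) :
    conj (g * h) Y = conj g (conj h Y) := by
  simp only [conj, _root_.mul_inv_rev, Matrix.SpecialLinearGroup.coe_mul, mul_assoc]

theorem conj_inv_conj (g : SL(2, k)) (Y : Matrix (Fin 2) (Fin 2) k) :
    conj g⁻¹ (conj g Y) = Y := by
  rw [← conj_mul]
  simp [conj]

/-- Torus elements have the form `x + y Y` with `Y` antidiagonal, so conjugating them reduces to
conjugating `Y`. -/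
theorem conj_add_smul (g : SL(2, k)) (x y : k) (Y : Matrix (Fin 2) (Fin 2) k) :
    conj g (x • (1 : Matrix (Fin 2) (Fin 2) k) + y • Y) = x • 1 + y • conj g Y := by
  have h1 : g.1 * (g⁻¹ : SL(2, k)).1 = 1 := by
    rw [← Matrix.SpecialLinearGroup.coe_mul]; simp
  simp only [conj, mul_add, add_mul, Matrix.mul_smul, Matrix.smul_mul, mul_one, h1]

theorem det_conj (g : SL(2, k)) (Y : Matrix (Fin 2) (Fin 2) k) : (conj g Y).det = Y.det := by
  simp only [conj, Matrix.det_mul, Matrix.SpecialLinearGroup.det_coe, one_mul, mul_one]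

theorem trace_antidiag_mul (u v x y : k) :
    Matrix.trace (antidiag u v * (x • (1 : Matrix (Fin 2) (Fin 2) k) + y • antidiag u v - 1))
      = 2 * y * (u * v) := by
  simp [Matrix.trace_fin_two, antidiag, Matrix.vecMul, dotProduct, Fin.sum_univ_two]
  ring

theorem antidiag_inj {u v u' v' : k} (h : antidiag u v = antidiag u' v') : u = u' ∧ v = v' :=
  ⟨by simpa [antidiag] using congrFun (congrFun h 0) 1,
    by simpa [antidiag] using congrFun (congrFun h 1) 0⟩

theorem conj_wMat (u v : k) : conj wMat (antidiag u v) = antidiag (-v) (-u) := by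
  apply conj_eq_of_mul_eq
  ext i j
  fin_cases i <;> fin_cases j <;> simp [wMat, antidiag, Matrix.mul_apply, Fin.sum_univ_two]

variable [ValuativeRel k] {ϖ : 𝒪[k]}

theorem conj_alphaPow (hϖ : Irreducible ϖ) (t : ℕ) (u v : k) :
    conj (alphaPow ϖ hϖ t) (antidiag u v)
      = antidiag ((ϖ : k) ^ (-2 * t : ℤ) * u) ((ϖ : k) ^ (2 * t : ℤ) * v) := by
  have h := coe_ne_zero_of_irreducible hϖ
  have h1 : (ϖ : k) ^ (2 * t : ℤ) = (ϖ : k) ^ t * (ϖ : k) ^ t := by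
    rw [← pow_add, ← two_mul]
    exact_mod_cast zpow_natCast (ϖ : k) (2 * t)
  apply conj_eq_of_mul_eq
  rw [neg_mul, _root_.zpow_neg, h1]
  ext i j
  fin_cases i <;> fin_cases j <;>
    simp [alphaPow, antidiag, Matrix.mul_apply, Fin.sum_univ_two] <;> field_simp

theorem eMat_coe (ε : 𝒪[k]ˣ) (x y : 𝒪[k]) (hxy : x ^ 2 - y ^ 2 * ε = ε) :
    (eMat ε x y hxy : Matrix (Fin 2) (Fin 2) k)
      = !![(x : k), y; y, (((ε⁻¹ : 𝒪[k]ˣ) : 𝒪[k]) : k) * x] := by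
  ext i j
  fin_cases i <;> fin_cases j <;> rfl

theorem eEtaMat_coe (hϖ : Irreducible ϖ) (ε : 𝒪[k]ˣ) (x y : 𝒪[k])
    (hxy : x ^ 2 - y ^ 2 * ε = ε) :
    (eEtaMat ϖ hϖ ε x y hxy : Matrix (Fin 2) (Fin 2) k)
      = !![(x : k), y * (ϖ : k)⁻¹; y * ϖ, (((ε⁻¹ : 𝒪[k]ˣ) : 𝒪[k]) : k) * x] := by
  have h := coe_ne_zero_of_irreducible hϖ
  change !![1, 0; 0, (ϖ : k)] * (eMat ε x y hxy : Matrix (Fin 2) (Fin 2) k)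
    * !![1, 0; 0, (ϖ : k)⁻¹] = _
  rw [eMat_coe]
  ext i j
  fin_cases i <;> fin_cases j <;> simp <;> field_simp

/-- The entries exchanged here have equal valuation, and `e^η` only moves the unit `ε` between
entries. Only `w` exchanges entries of different valuation, whence the sign of `y` in `δ(μ)`. -/
theorem conj_eMat (ε : 𝒪[k]ˣ) (x y : 𝒪[k]) (hxy : x ^ 2 - y ^ 2 * ε = ε) (a : k) :
    conj (eMat ε x y hxy) (antidiag a (a * (ε : 𝒪[k]))) = antidiag (a * (ε : 𝒪[k])) a := by
  have hε : (((ε⁻¹ : 𝒪[k]ˣ) : 𝒪[k]) : k) * (ε : 𝒪[k]) = 1 := by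
    rw [← Subring.coe_mul]
    simp
  apply conj_eq_of_mul_eq
  rw [eMat_coe]
  ext i j
  fin_cases i <;> fin_cases j <;> simp [antidiag, -mul_eq_mul_left_iff]
  · ring
  · linear_combination -a * x * hε
  · linear_combination a * x * hε
  · ring

theorem conj_eEtaMat (hϖ : Irreducible ϖ) (ε : 𝒪[k]ˣ) (x y : 𝒪[k])
    (hxy : x ^ 2 - y ^ 2 * ε = ε) (a : k) :
    conj (eEtaMat ϖ hϖ ε x y hxy) (antidiag (a * (ϖ : k)⁻¹) (a * ((ε : 𝒪[k]) * ϖ)))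
      = antidiag (a * (ε : 𝒪[k]) * (ϖ : k)⁻¹) (a * ϖ) := by
  have h := coe_ne_zero_of_irreducible hϖ
  have hε : (((ε⁻¹ : 𝒪[k]ˣ) : 𝒪[k]) : k) * (ε : 𝒪[k]) = 1 := by
    rw [← Subring.coe_mul]
    simp
  apply conj_eq_of_mul_eq
  rw [eEtaMat_coe]
  ext i j
  fin_cases i <;> fin_cases j <;> simp [antidiag, -mul_eq_mul_left_iff] <;> field_simp
  · linear_combination -a * x * hε
  · linear_combination a * x * hε

end Conjugation

/-! ### Valuations of the entries of `Γ^μ`, and `φ^μ` near the identity. -/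

section Generic

variable {k : Type*} [Field k] [ValuativeRel k] {ϖ : 𝒪[k]} {ε : 𝒪[k]ˣ} {τ : TorusLabel} {r : ℝ} {a : k}

theorem smul_basis (a : k) : a • τ.basis ϖ ε = antidiag (a * τ.γ₁ ϖ ε) (a * τ.γ₂ ϖ ε) := by
  ext i j
  fin_cases i <;> fin_cases j <;> simp [TorusLabel.basis, antidiag]

/-- `val(γ₂) = val(γ₁) + 2y`. -/
theorem exists_γ₂_eq (hϖ : Irreducible ϖ) (ε : 𝒪[k]ˣ) (τ : TorusLabel) :
    ∃ (c : 𝒪[k]ˣ) (j : ℤ), (j : ℝ) = 2 * τ.y ∧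
      τ.γ₂ ϖ ε = ((c : 𝒪[k]) : k) * (ϖ : k) ^ j * τ.γ₁ ϖ ε := by
  have h := coe_ne_zero_of_irreducible hϖ
  have hε : (((ε⁻¹ : 𝒪[k]ˣ) : 𝒪[k]) : k) * (ε : 𝒪[k]) = 1 := by
    rw [← Subring.coe_mul]
    simp
  have hε0 := right_ne_zero_of_mul_eq_one hε
  cases τ
  · exact ⟨ε, 0, by simp [TorusLabel.y], by simp [TorusLabel.γ₁, TorusLabel.γ₂]⟩
  · exact ⟨ε, 2, by norm_num [TorusLabel.y], by simp [TorusLabel.γ₁, TorusLabel.γ₂]; field_simp⟩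
  · exact ⟨1, 1, by norm_num [TorusLabel.y], by simp [TorusLabel.γ₁, TorusLabel.γ₂]⟩
  · refine ⟨ε⁻¹ ^ 2, 1, by norm_num [TorusLabel.y], ?_⟩
    rw [TorusLabel.γ₁, TorusLabel.γ₂, inv_eq_of_mul_eq_one_left hε]
    rw [zpow_one]
    push_cast
    linear_combination -(((ε⁻¹ : 𝒪[k]ˣ) : 𝒪[k]) : k) * ϖ * hε
  · exact ⟨ε, 1, by norm_num [TorusLabel.y], by simp [TorusLabel.γ₁, TorusLabel.γ₂]⟩
  · refine ⟨ε⁻¹, 1, by norm_num [TorusLabel.y], ?_⟩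
    rw [TorusLabel.γ₁, TorusLabel.γ₂, zpow_one]
    linear_combination -(ϖ : k) * hε

variable [TopologicalSpace k] [IsNonarchimedeanLocalField k]

/-- The valuations of the entries of `Γ^λ`. -/
theorem exists_conj_lambdaMat_eq (hϖ : Irreducible ϖ) (x y : 𝒪[k]) (hxy : x ^ 2 - y ^ 2 * ε = ε)
    (ha : IsGeneric ϖ ε τ r a) (μ : MackeyIndex) :
    ∃ (u v : k) (m n : ℤ),
      conj (lambdaMat ϖ hϖ ε x y hxy τ μ.lam) (a • τ.basis ϖ ε) = antidiag u v ∧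
      HasVal ϖ u m ∧ HasVal ϖ v n ∧
      (m : ℝ) = 2 * μ.t - r - μ.delta τ ∧ (n : ℝ) = μ.delta τ - 2 * μ.t - r := by
  obtain ⟨n, hn, h1⟩ := ha
  obtain ⟨c, j, hj, hγ⟩ := exists_γ₂_eq hϖ ε τ
  have h2 : HasVal ϖ (a * τ.γ₂ ϖ ε) (n + j) := by
    have := h1.mul hϖ ((hasVal_unit hϖ c).mul hϖ (hasVal_zpow hϖ j))
    rw [zero_add] at this
    convert! this using 1
    rw [hγ]
    ring
  have hε := hasVal_unit hϖ ε
  rw [smul_basis]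
  obtain ⟨t, l, hl⟩ := μ
  cases l
  · refine ⟨_, _, n, n + j, by simp [lambdaMat, conj], h1, h2, ?_, ?_⟩ <;> push_cast <;>
      rw [hn] <;> cases τ <;>
      simp only [MackeyIndex.delta, TorusLabel.y] at hj ⊢ <;> linarith
  · have hw (hτ : lambdaMat ϖ hϖ ε x y hxy τ .d = wMat) (hδ : MackeyIndex.delta ⟨t, .d, hl⟩ τ
        = 2 * t - τ.y) : ∃ (u v : k) (m n : ℤ),
        conj (lambdaMat ϖ hϖ ε x y hxy τ .d) (antidiag (a * τ.γ₁ ϖ ε) (a * τ.γ₂ ϖ ε))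
          = antidiag u v ∧ HasVal ϖ u m ∧ HasVal ϖ v n ∧
        (m : ℝ) = 2 * t - r - MackeyIndex.delta ⟨t, .d, hl⟩ τ ∧
        (n : ℝ) = MackeyIndex.delta ⟨t, .d, hl⟩ τ - 2 * t - r := by
      refine ⟨_, _, n + j, n, by rw [hτ, conj_wMat], h2.neg, h1.neg, ?_, ?_⟩ <;> push_cast <;>
        rw [hn, hδ] <;> linarith
    cases τ
    · rw [TorusLabel.γ₁, mul_one] at h1
      refine ⟨a * (ε : 𝒪[k]), a, n, n, ?_, by simpa using h1.mul hϖ hε, h1, ?_, ?_⟩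
      · rw [TorusLabel.γ₁, TorusLabel.γ₂, mul_one]
        exact conj_eMat ε x y hxy a
      · rw [hn]
        simp [MackeyIndex.delta, TorusLabel.y]
      · rw [hn]
        simp [MackeyIndex.delta, TorusLabel.y]
    · have hj2 : j = 2 := by
        have : (j : ℝ) = 2 := by simpa [TorusLabel.y] using hj
        exact_mod_cast this
      subst hj2
      refine ⟨a * (ε : 𝒪[k]) * (ϖ : k)⁻¹, a * ϖ, n, n + 2,
        conj_eEtaMat hϖ ε x y hxy a, ?_, ?_, ?_, ?_⟩
      · convert! h1.mul hϖ hε using 1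
        · rw [TorusLabel.γ₁]
          ring
        · ring
      · convert! h2.mul hϖ (hε.inv hϖ) using 1
        · rw [TorusLabel.γ₂]
          field_simp [hε.ne_zero]
        · ring
      · rw [hn]
        simp [MackeyIndex.delta, TorusLabel.y]
        ring
      · push_cast
        rw [hn]
        simp [MackeyIndex.delta, TorusLabel.y]
        ring
    all_goals exact hw rfl rfl

/-- The valuations of the entries of `Γ^μ`. -/
theorem exists_hasVal_conj (hϖ : Irreducible ϖ) (x y : 𝒪[k]) (hxy : x ^ 2 - y ^ 2 * ε = ε)
    (ha : IsGeneric ϖ ε τ r a) (μ : MackeyIndex) {u v : k}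
    (hX : conj (μ.mat ϖ hϖ ε x y hxy τ) (a • τ.basis ϖ ε) = antidiag u v) :
    ∃ m n : ℤ, HasVal ϖ u m ∧ HasVal ϖ v n ∧ (m : ℝ) = -(r + μ.delta τ) ∧
      (n : ℝ) = μ.delta τ - r := by
  obtain ⟨u₀, v₀, m, n, h, hu, hv, hm, hn⟩ := exists_conj_lambdaMat_eq hϖ x y hxy ha μ
  rw [MackeyIndex.mat, conj_mul, h, conj_alphaPow] at hX
  obtain ⟨rfl, rfl⟩ := antidiag_inj hX
  refine ⟨_, _, (hasVal_zpow hϖ _).mul hϖ hu, (hasVal_zpow hϖ _).mul hϖ hv, ?_, ?_⟩ <;>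
    push_cast <;> linarith

/-- The restriction of `φ^μ` near the identity is given by `Γ^μ`. -/
theorem isNearIdentity_conjChar (hp : ringChar 𝓀[k] ≠ 2) (hϖ : Irreducible ϖ)
    (hr : 0 < r) {Ψ : AddChar k ℂ}
    (φ : τ.torus ϖ ε →* ℂˣ) (ha : IsGeneric ϖ ε τ r a)
    (hΓ : Represents Ψ ϖ ε τ φ (r / 2) (a • τ.basis ϖ ε)) (g : SL(2, k)) {u v : k}
    (hX : conj g (a • τ.basis ϖ ε) = antidiag u v) {d : ℕ} {V : ℤ} (hu : HasVal ϖ u (-d))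
    (hv : HasVal ϖ v V) (hdV : 0 < d + V) (hr' : 2 * r = d - V) :
    IsNearIdentity Ψ ϖ d V u v (conjChar hϖ ha φ g hX) := by
  intro t m h00 h01 hm
  obtain ⟨n, hn, hγ⟩ := ha
  obtain ⟨q, hq⟩ := exists_quotient hϖ hu hv hdV.le
  have hu0 := hu.ne_zero
  have hqF := coe_quotient_mem hϖ hu hv hq
  have hqm : q ∈ 𝓂[k] := (mem_maximalIdeal_iff hϖ).2 (fracIdeal_anti hϖ (by omega) hqF)
  obtain ⟨e11, e10⟩ := (mem_centK_antidiag_iff hu0 hq).1 t.2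
  have hm' : (0 : ℝ) < 4 * m + d + 3 * V := by exact_mod_cast hm
  set A := t.1 0 0
  set b := t.1 0 1
  have hinc : (incl t.1 : SL(2, k)).1
      = (A : k) • (1 : Matrix (Fin 2) (Fin 2) k) + ((b : k) * u⁻¹) • antidiag u v := by
    ext i j
    fin_cases i <;> fin_cases j
    · simp [incl_coe, antidiag, A]
    · simp [incl_coe, antidiag, hu0, b]
    · simp only [Fin.mk_one, Fin.zero_eta, incl_coe, e10, ← hq]
      simp [antidiag, hu0]
      field_simp
    · simp [incl_coe, antidiag, e11]
  have hcoe : (g⁻¹ * incl t.1 * g : SL(2, k)).1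
      = (A : k) • (1 : Matrix (Fin 2) (Fin 2) k) + ((b : k) * u⁻¹) • (a • τ.basis ϖ ε) := by
    rw [← conj_inv_conj g (a • τ.basis ϖ ε), hX, ← conj_add_smul, ← hinc]
    simp [conj]
  -- Conjugation preserves the determinant, so the trace against `Γ` will be `2 (b/u)(u v) = 2 b v`.
  have hdet : a * τ.γ₁ ϖ ε * (a * τ.γ₂ ϖ ε) = u * v := by
    have := congrArg Matrix.det hX
    rw [det_conj, smul_basis] at this
    simpa [antidiag, Matrix.det_fin_two] using this
  have hfilt : InTorusFiltPlus ϖ ε τ (r / 2)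
      ⟨g⁻¹ * incl t.1 * g, conj_mem_torus hϖ ⟨n, hn, hγ⟩ g hX t⟩ := by
    constructor
    · have e : (g⁻¹ * incl t.1 * g : SL(2, k)).1 0 0 = A := by
        rw [hcoe, smul_basis]
        simp [antidiag]
      change (g⁻¹ * incl t.1 * g : SL(2, k)).1 0 0 - 1 ∈ _
      obtain ⟨c, hc⟩ := exists_sub_eq_mul_sq hp hqm (centK_sq ⟨e11, e10⟩) (one_pow 2) h00
      have hc' := congrArg Subtype.val hc
      push_cast at hc'
      rw [e, hc', sq]
      -- The diagonal condition has room to spare: `A - 1 = c q b²` has valuation at least `d + V +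
      -- 2m > (d - V)/2 = r > r/2`.
      refine fracIdeal_anti hϖ ?_ (coe_mul_mem_fracIdeal hϖ c
        (mul_mem_fracIdeal hϖ hqF (mul_mem_fracIdeal hϖ h01 h01)))
      have hdV' : (0 : ℝ) < d + V := by exact_mod_cast hdV
      refine Int.add_one_le_iff.2 (Int.floor_lt.2 ?_)
      push_cast
      linarith
    · have e : (g⁻¹ * incl t.1 * g : SL(2, k)).1 0 1 = (b : k) * u⁻¹ * (a * τ.γ₁ ϖ ε) := by
        rw [hcoe, smul_basis]
        simp [antidiag]
      change (g⁻¹ * incl t.1 * g : SL(2, k)).1 0 1 ∈ _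
      rw [e]
      -- The valuation is at least `m + d - r - y`. This exceeds `r/2 - y` exactly when `m + d >
      -- 3r/2`, and `2r = d - V` turns this into the inequality `4m + d + 3V > 0` of
      -- `IsNearIdentity`.
      refine fracIdeal_anti hϖ ?_ (mul_mem_fracIdeal hϖ
        (mul_mem_fracIdeal hϖ h01 (hu.inv hϖ).mem) hγ.mem)
      refine Int.add_one_le_iff.2 (Int.floor_lt.2 ?_)
      push_cast
      linarith
  refine (hΓ _ hfilt).trans ?_
  rw [psiTr]
  congr 1
  change Matrix.trace (_ * ((g⁻¹ * incl t.1 * g : SL(2, k)).1 - 1)) = _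
  rw [hcoe, smul_basis]
  rw [trace_antidiag_mul, hdet]
  field_simp

end Generic

end SL2Branching

/-! ### The proposition, assembled from the valuations of `u` and `v`. -/

theorem proposition7p5
    {k : Type*} [Field k] [ValuativeRel k] [TopologicalSpace k] [IsNonarchimedeanLocalField k]
    (hp : ringChar 𝓀[k] ≠ 2)
    (ϖ : 𝒪[k]) (hϖ : Irreducible ϖ)
    (ε : 𝒪[k]ˣ) (hε : ¬ IsSquare ε)
    (Ψ : AddChar k ℂ) (hΨ : ∀ x ∈ 𝓂[k], Ψ (x : k) = 1) (hΨ' : ∃ x : 𝒪[k], Ψ (x : k) ≠ 1)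
    (x₀ y₀ : 𝒪[k]) (hxy : x₀ ^ 2 - y₀ ^ 2 * ε = ε)
    -- the datum `(𝒯, y, r, φ)` and the generic element `Γ = a X_𝒯` representing `φ`
    (τ : TorusLabel) (r : ℝ) (hr : 0 < r)
    (φ : τ.torus ϖ ε →* ℂˣ) (hφ : TorusHasDepth ϖ ε τ φ r)
    (a : k) (ha : IsGeneric ϖ ε τ r a) (hΓ : Represents Ψ ϖ ε τ φ (r / 2) (a • τ.basis ϖ ε))
    -- the double coset representative `μ`, with `d = r + δ(μ) > (4/3) r`, and `Γ^μ = X(u, v)`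
    (μ : MackeyIndex) (hd : 4 / 3 * r < r + μ.delta τ)
    (u v : k) (hX : conj (μ.mat ϖ hϖ ε x₀ y₀ hxy τ) (a • τ.basis ϖ ε) = antidiag u v) :
    ∃ d : ℕ, (d : ℝ) = r + μ.delta τ ∧
      -- `S_d(φ^μ, Γ^μ)` is defined
      IsShalikaDatum Ψ ϖ d u v (conjChar hϖ ha φ (μ.mat ϖ hϖ ε x₀ y₀ hxy τ) hX) ∧
      -- `T(X') = Z U` for `X' = X(u, 0)`
      centK (antidiag u 0) = Subgroup.center SL(2, 𝒪[k]) ⊔ unipK ∧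
      -- every element of `T(X')` has exactly one transfer to `T(Γ^μ)`
      (∀ t' : centK (antidiag u 0), ∃! t : centK (antidiag u v), IsTransfer u v u 0 t' t) ∧
      ∃ θ' : centK (antidiag u 0) →* ℂˣ,
        -- `S_d(θ', X')` is defined
        IsShalikaDatum Ψ ϖ d u 0 θ' ∧
        -- `θ'` agrees with `φ` on the center `Z`
        (∀ (t' : centK (antidiag u 0)) (z : τ.torus ϖ ε),
          (z : SL(2, k)) ∈ Subgroup.center SL(2, k) → incl t'.1 = z → θ' t' = φ z) ∧
        Nonempty ((shalikaRep Ψ d (antidiag u v)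
            (conjChar hϖ ha φ (μ.mat ϖ hϖ ε x₀ y₀ hxy τ) hX)).Equiv
          (shalikaRep Ψ d (antidiag u 0) θ')) ∧
        -- `θ'(t') = φ^μ(t) Ψ(z b v)⁻¹` for `t' = t(z, b)` with transfer `t`
        (∀ (t' : centK (antidiag u 0)) (t : centK (antidiag u v)), IsTransfer u v u 0 t' t →
          (θ' t' : ℂ) = (conjChar hϖ ha φ (μ.mat ϖ hϖ ε x₀ y₀ hxy τ) hX t : ℂ) *
            (Ψ (((t'.1 0 0 : 𝒪[k]) : k) * (t'.1 0 1 : 𝒪[k]) * v))⁻¹) ∧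
        -- the depth of `θ'`
        ((d : ℝ) ≤ 2 * r → CharHasDepth (centK (antidiag u 0)) θ' (2 * r - d)) ∧
        (2 * r < d → ∀ t' : centK (antidiag u 0), t'.1 ∈ unipK → θ' t' = 1) := by
  obtain ⟨m, V, hu, hv, hm, hVr⟩ := exists_hasVal_conj hϖ x₀ y₀ hxy ha μ hX
  have hm0 : m < 0 := by
    have : (m : ℝ) < 0 := by linarith
    exact_mod_cast this
  -- The integrality of `d` comes from the integer valuation of `u`.
  obtain ⟨d, rfl⟩ : ∃ d : ℕ, m = -d := ⟨m.natAbs, by omega⟩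
  push_cast at hm
  have hdr : (d : ℝ) = r + μ.delta τ := by linarith
  have hr' : 2 * r = d - V := by linarith
  have hVd : V < d := by
    have : (V : ℝ) < d := by linarith
    exact_mod_cast this
  -- Since `V = d - 2r`, this is `3d > 4r`.
  have hdV : 0 < d + 2 * V := by
    have : (0 : ℝ) < d + 2 * V := by linarith
    exact_mod_cast this
  have hd0 : 0 < d := by omega
  have hN : 0 < d + V := by omega
  have hu0 := hu.ne_zero
  obtain ⟨q, hq⟩ := exists_quotient hϖ hu hv hN.le
  have hqF := coe_quotient_mem hϖ hu hv hq
  have hqm : q ∈ 𝓂[k] := (mem_maximalIdeal_iff hϖ).2 (fracIdeal_anti hϖ (by omega) hqF)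
  have hqd : q ∈ 𝓂[k] ^ (d / 2 + 1) :=
    (mem_maximalIdeal_pow_iff hϖ).2 (fracIdeal_anti hϖ (by push_cast; omega) hqF)
  have hΨF : ∀ x ∈ fracIdeal ϖ 1, Ψ x = 1 := by
    intro x hx
    obtain ⟨c, rfl⟩ := mem_fracIdeal_iff.1 hx
    have hc : c * ϖ ∈ 𝓂[k] := Ideal.mul_mem_left _ _ ((IsLocalRing.mem_maximalIdeal ϖ).2 hϖ.1)
    simpa using hΨ _ hc
  have hθ := isNearIdentity_conjChar hp hϖ hr φ ha hΓ _ hX hu hv hN hr'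
  have hdatum := hθ.isShalikaDatum hϖ hΨF hu hd0 hv hq hqm hN
  obtain ⟨θ', hθ'⟩ := hθ.exists_isDegeneration hp hϖ hΨF hu hv hq hqm hVd hdV
  obtain ⟨χ, hχ⟩ := hdatum.2.2
  refine ⟨d, hdr, hdatum, centK_nilp_eq hu0, existsUnique_transfer hp hu0 hq hqm, θ',
    hθ'.isShalikaDatum hp hϖ hΨF hu hd0 hv hq hqm hqd hdV hχ, fun t' z hz hzt => ?_,
    hθ'.nonempty_equiv hp hϖ hΨF hu0 hv hq hqm hqd hdV hχ, hθ', fun hle => ?_, fun hlt => ?_⟩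
  · obtain ⟨c, -, hc⟩ := Matrix.SpecialLinearGroup.mem_center_iff.1 hz
    have h01 : t'.1 0 1 = 0 := by
      apply Subtype.ext
      rw [← incl_coe, hzt, ← hc]
      simp
    obtain ⟨h11, h10⟩ := (mem_centK_nilp_iff hu0).1 t'.2
    -- With `b = 0`, a central element lies in both centralizers and is its own transfer.
    have ht : t'.1 ∈ centK (antidiag u v) :=
      (mem_centK_antidiag_iff hu0 hq).2 ⟨h11, by rw [h10, h01, mul_zero]⟩
    apply Units.ext
    rw [hθ' t' ⟨t'.1, ht⟩ ((isTransfer_iff hp hu0 hq hqm).2 ⟨rfl, by simp⟩), h01]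
    simp only [ZeroMemClass.coe_zero, mul_zero, zero_mul, AddChar.map_zero_eq_one, inv_one,
      mul_one, conjChar, MonoidHom.coe_mk, OneHom.coe_mk, Units.val_inj]
    congr 1
    apply Subtype.ext
    change _⁻¹ * incl t'.1 * _ = _
    rw [hzt, mul_assoc, ← Subgroup.mem_center_iff.1 hz, inv_mul_cancel_left]
  · have hV0 : V ≤ 0 := by
      have : (V : ℝ) ≤ 0 := by linarith
      exact_mod_cast this
    obtain ⟨n, hn⟩ := Int.eq_ofNat_of_zero_le (neg_nonneg.2 hV0)
    have hnr : 2 * r - d = (n : ℝ) := by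
      rw [← Int.cast_natCast n, ← hn]
      push_cast
      linarith
    rw [hnr]
    exact hθ'.charHasDepth hθ hp hϖ hΨF hΨ' hu0 hv hq hqm hVd hn.symm
  · have hV0 : 0 < V := by
      have : (0 : ℝ) < V := by linarith
      exact_mod_cast this
    exact hθ'.apply_unipK hθ hp hϖ hΨF hu0 hv hq hqm hV0
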